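/- Let $r_0 > 0$, $|w_0| \le 1$ and $U_0 \in \mathbb{R}$ be such that $E_0 := 1 + 2U_0^2 - \frac{(1-w_0^2)^2}{r_0^2} \ge 0$. Let $(r,N,w,U,\kappa,\zeta)$, with $r>0$, be the solution, maximally extended to the right of $\rho = 0$, of the system $$\dot r = rN,\quad \dot N = 1 - \tfrac{(1-w^2)^2}{r^2} - \kappa N,\quad \dot w = rU,\quad \dot U = -(\kappa - N)U - \tfrac{w(1-w^2)}{r},\quad \dot\kappa = 1 + 2U^2 - \kappa^2,\quad \dot\zeta = -\kappa\zeta$$ with initial conditions $$r(0)=r_0,\quad N(0)=0,\quad w(0)=w_0,\quad U(0)=U_0,\quad \kappa(0)=0,\quad \zeta(0)=\sqrt{E_0}.$$ Then the solution, considered for $\rho \ge 0$, belongs to exactly one of the following classes. (i) Singular: its interval of existence is $[0,\rho_\infty)$ for a finite $\rho_\infty > 0$; $r \to 0$ and $N \to -\infty$ as $\rho \to \rho_\infty$, and $w, U, \kappa, \zeta$ remain bounded as $\rho \to \rho_\infty$. (ii) Asymptotically cylindrical: it is defined for all $\rho \ge 0$ and satisfies $|w| \le 1$ for all $\rho\ge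 0$; as $\rho \to \infty$, $r \to 1$, $N \to 0$, $\zeta \to 0$ and $\kappa \to 1$. Furthermore, either $r \equiv 1$ and $w \equiv 0$; or $r_0 < 1$, $(w,U) \to (0,0)$ as $\rho \to \infty$, and $w$ has infinitely many zeros. (iii) Asymptotically flat: it is defined for all $\rho \ge 0$ and satisfies $|w| \le 1$ for all $\rho\ge 0$; as $\rho \to \infty$, $r \to \infty$, $r(1-N^2) \to \beta$, $r\zeta \to \alpha$ and $\kappa \to 1$, for some $0 \le \beta < \infty$ and $0 < \alpha < \infty$. Furthermore, either $r_0 > 1$ and $w \equiv 0$; or $(w, rU) \to (1,0)$ or $(w,rU) \to (-1,0)$ as $\rho \to \infty$. -/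

import Mathlib

open Filter Topology

namespace HauntedEYM

/-- The initial energy `E₀ = 1 + 2 U₀² - (1 - w₀²)² / r₀²`. -/
noncomputable def initialEnergy (r₀ w₀ U₀ : ℝ) : ℝ :=
  1 + 2 * U₀ ^ 2 - (1 - w₀ ^ 2) ^ 2 / r₀ ^ 2

/-- The set of admissible initial data `(r₀, w₀, U₀)`. -/
def admissibleData : Set (ℝ × ℝ × ℝ) :=
  {p | 0 < p.1 ∧ |p.2.1| ≤ 1 ∧ 0 ≤ initialEnergy p.1 p.2.1 p.2.2}

/-- The six dependent variables, as functions of the radial variable `ρ`. -/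
structure Variables where
  /-- the radial function -/
  r : ℝ → ℝ
  /-- the logarithmic derivative of `r` -/
  N : ℝ → ℝ
  /-- the Yang-Mills potential -/
  w : ℝ → ℝ
  /-- the derivative of `w`, divided by `r` -/
  U : ℝ → ℝ
  /-- the variable `κ` -/
  κ : ℝ → ℝ
  /-- the phantom variable `ζ` -/
  ζ : ℝ → ℝ

/-- The half-open interval `[0, b)`, where `b` may be infinite. -/
def forwardInterval (b : EReal) : Set ℝ := {ρ | 0 ≤ ρ ∧ (ρ : EReal) < b}

/-- `y` solves the initial value problem with data `(r₀, w₀, U₀)` on `[0, b)`, `0 < b ≤ ∞`.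
The phase space is `{r > 0}`; the derivative at `ρ = 0` is one-sided. Values of `y` outside
`[0, b)` are irrelevant. -/
structure IsSolutionOn (r₀ w₀ U₀ : ℝ) (b : EReal) (y : Variables) : Prop where
  b_pos : 0 < b
  r_pos : ∀ ρ ∈ forwardInterval b, 0 < y.r ρ
  deriv_r : ∀ ρ ∈ forwardInterval b,
    HasDerivWithinAt y.r (y.r ρ * y.N ρ) (forwardInterval b) ρ
  deriv_N : ∀ ρ ∈ forwardInterval b,
    HasDerivWithinAt y.N (1 - (1 - y.w ρ ^ 2) ^ 2 / y.r ρ ^ 2 - y.κ ρ * y.N ρ)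
      (forwardInterval b) ρ
  deriv_w : ∀ ρ ∈ forwardInterval b,
    HasDerivWithinAt y.w (y.r ρ * y.U ρ) (forwardInterval b) ρ
  deriv_U : ∀ ρ ∈ forwardInterval b,
    HasDerivWithinAt y.U (-(y.κ ρ - y.N ρ) * y.U ρ - y.w ρ * (1 - y.w ρ ^ 2) / y.r ρ)
      (forwardInterval b) ρ
  deriv_κ : ∀ ρ ∈ forwardInterval b,
    HasDerivWithinAt y.κ (1 + 2 * y.U ρ ^ 2 - y.κ ρ ^ 2) (forwardInterval b) ρ
  deriv_ζ : ∀ ρ ∈ forwardInterval b,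
    HasDerivWithinAt y.ζ (-y.κ ρ * y.ζ ρ) (forwardInterval b) ρ
  init_r : y.r 0 = r₀
  init_N : y.N 0 = 0
  init_w : y.w 0 = w₀
  init_U : y.U 0 = U₀
  init_κ : y.κ 0 = 0
  init_ζ : y.ζ 0 = Real.sqrt (initialEnergy r₀ w₀ U₀)

/-- `y` and `y'` have the same values on the set `s`. -/
def AgreeOn (y y' : Variables) (s : Set ℝ) : Prop :=
  Set.EqOn y.r y'.r s ∧ Set.EqOn y.N y'.N s ∧ Set.EqOn y.w y'.w s ∧
    Set.EqOn y.U y'.U s ∧ Set.EqOn y.κ y'.κ s ∧ Set.EqOn y.ζ y'.ζ s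

/-- `y` is a maximally extended (forward) solution and `[0, b)` is its interval of existence. -/
def IsMaximalSolution (r₀ w₀ U₀ : ℝ) (b : EReal) (y : Variables) : Prop :=
  IsSolutionOn r₀ w₀ U₀ b y ∧
    ∀ (b' : EReal) (y' : Variables), b < b' → IsSolutionOn r₀ w₀ U₀ b' y' →
      ¬ AgreeOn y y' (forwardInterval b)

/-- Singular: the solution ceases to exist at a finite `ρ∞ > 0`, where `r → 0`, `N → -∞`, and
the remaining variables stay bounded. -/
def IsSingular (b : EReal) (y : Variables) : Prop :=
  ∃ ρinf : ℝ, 0 < ρinf ∧ b = (ρinf : EReal) ∧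
    Tendsto y.r (𝓝[<] ρinf) (𝓝 0) ∧
    Tendsto y.N (𝓝[<] ρinf) atBot ∧
    ∃ C : ℝ, ∀ᶠ ρ in 𝓝[<] ρinf,
      |y.w ρ| ≤ C ∧ |y.U ρ| ≤ C ∧ |y.κ ρ| ≤ C ∧ |y.ζ ρ| ≤ C

/-- Asymptotically cylindrical solutions (`r₀` is the initial value of `r`). -/
def IsAsymptoticallyCylindrical (r₀ : ℝ) (b : EReal) (y : Variables) : Prop :=
  b = ⊤ ∧ (∀ ρ : ℝ, 0 ≤ ρ → |y.w ρ| ≤ 1) ∧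
    Tendsto y.r atTop (𝓝 1) ∧ Tendsto y.N atTop (𝓝 0) ∧
    Tendsto y.ζ atTop (𝓝 0) ∧ Tendsto y.κ atTop (𝓝 1) ∧
    ((∀ ρ : ℝ, 0 ≤ ρ → y.r ρ = 1 ∧ y.w ρ = 0) ∨
      (r₀ < 1 ∧ Tendsto y.w atTop (𝓝 0) ∧ Tendsto y.U atTop (𝓝 0) ∧
        {ρ : ℝ | 0 ≤ ρ ∧ y.w ρ = 0}.Infinite))

/-- Asymptotically flat solutions (`r₀` is the initial value of `r`). -/
def IsAsymptoticallyFlat (r₀ : ℝ) (b : EReal) (y : Variables) : Prop :=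
  b = ⊤ ∧ (∀ ρ : ℝ, 0 ≤ ρ → |y.w ρ| ≤ 1) ∧
    Tendsto y.r atTop atTop ∧
    (∃ β : ℝ, 0 ≤ β ∧ Tendsto (fun ρ => y.r ρ * (1 - y.N ρ ^ 2)) atTop (𝓝 β)) ∧
    (∃ α : ℝ, 0 < α ∧ Tendsto (fun ρ => y.r ρ * y.ζ ρ) atTop (𝓝 α)) ∧
    Tendsto y.κ atTop (𝓝 1) ∧
    ((1 < r₀ ∧ ∀ ρ : ℝ, 0 ≤ ρ → y.w ρ = 0) ∨
      ((Tendsto y.w atTop (𝓝 1) ∨ Tendsto y.w atTop (𝓝 (-1))) ∧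
        Tendsto (fun ρ => y.r ρ * y.U ρ) atTop (𝓝 0)))

end HauntedEYM

/-! The lifetime separates class (i) from the others, and for global solutions the growth of `r`
separates (ii) from (iii). Everything rests on the Hamiltonian constraint, which expresses `V`
through the other variables, and on `κ ≥ 0`, `N ≤ κ` and an upper bound for `κ + N` (`constraint`,
`N_le_κ`, `κ_add_N_le`).

Finite lifetime: on a bounded interval `r`, `w`, `U`, `κ`, `ζ` stay bounded (`exists_w_le`,
`exists_sq_U_le`), so a maximal solution can only stop because `N` is unbounded below. A
sufficiently negative `N` decreases, hence `N → -∞`; and `r → 0`, since otherwise `V` would be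
bounded and `N` could not diverge in finite time.

Infinite lifetime: `N` is bounded below, as otherwise its Riccati inequality would blow up (`N_ge`),
and `|w| ≤ 1`, as otherwise the growth of `w` would drive `N` to `-∞` (`w_le_one`). From `ρ = 1` on,
`N ≥ -ζ²`, which makes `log r - ζ²` monotone: `r` has a positive limit or tends to infinity
(`r_dichotomy`).

If `r → R`, a Barbalat argument gives `N → 0`. The energy, whose derivative has the sign of `2N -
κ`, then decreases, so `rU → 0` and `w` tends to a critical point `m` of the potential. The equation
for `N` forces `(1 - m²)² = R²`, hence `m = 0` and `R = 1`. A Riccati equation for `ẇ/w` gives the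
oscillation, and `r₀ ≥ 1` makes `r` nondecreasing, hence constant.

If `r → ∞`, then `V → 0`, `N → 1`, `κ → 1`, and the energy increases instead. Again `w` tends to a
critical point; the limit `0` occurs only for `w ≡ 0`, because there the energy is at its minimum
`-1`. Monotone modifications of `r(1 - N²)` and of `log (rζ)` yield `β` and the positivity of `α`.
-/

namespace HauntedEYM

open Set

/-! ### Differential inequalities on compact intervals. -/

section Calculus

variable {f f' g : ℝ → ℝ} {s t : ℝ}

/-- A function with nonnegative derivative on an interval is monotone. -/
lemma monotoneOn_of_hasDeriv (hf : ∀ x ∈ Icc s t, HasDerivWithinAt f (f' x) (Icc s t) x)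
    (h : ∀ x ∈ Icc s t, 0 ≤ f' x) : MonotoneOn f (Icc s t) := by
  refine monotoneOn_of_hasDerivWithinAt_nonneg (convex_Icc s t)
    (fun x hx => (hf x hx).continuousWithinAt) (f' := f') (fun x hx => ?_) fun x hx => ?_
  · exact (hf x (interior_subset hx)).mono interior_subset
  · exact h x (interior_subset hx)

lemma le_of_hasDeriv_nonneg (hst : s ≤ t)
    (hf : ∀ x ∈ Icc s t, HasDerivWithinAt f (f' x) (Icc s t) x)
    (h : ∀ x ∈ Icc s t, 0 ≤ f' x) : f s ≤ f t :=
  monotoneOn_of_hasDeriv hf h (left_mem_Icc.2 hst) (right_mem_Icc.2 hst) hst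

lemma le_of_hasDeriv_nonpos (hst : s ≤ t)
    (hf : ∀ x ∈ Icc s t, HasDerivWithinAt f (f' x) (Icc s t) x)
    (h : ∀ x ∈ Icc s t, f' x ≤ 0) : f t ≤ f s := by
  have := le_of_hasDeriv_nonneg hst (fun x hx => (hf x hx).neg)
    (fun x hx => by linarith [h x hx])
  simpa using this

/-- Mean value inequality, from below. -/
lemma add_mul_le_of_hasDeriv (hst : s ≤ t) {c : ℝ}
    (hf : ∀ x ∈ Icc s t, HasDerivWithinAt f (f' x) (Icc s t) x)
    (h : ∀ x ∈ Icc s t, c ≤ f' x) : f s + c * (t - s) ≤ f t := by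
  have := le_of_hasDeriv_nonneg (f := fun x => f x - c * x) (f' := fun x => f' x - c * 1) hst
    (fun x hx => (hf x hx).sub ((hasDerivWithinAt_id x _).const_mul c))
    (fun x hx => by linarith [h x hx])
  linarith

/-- Mean value inequality, from above. -/
lemma le_add_mul_of_hasDeriv (hst : s ≤ t) {c : ℝ}
    (hf : ∀ x ∈ Icc s t, HasDerivWithinAt f (f' x) (Icc s t) x)
    (h : ∀ x ∈ Icc s t, f' x ≤ c) : f t ≤ f s + c * (t - s) := by
  have := add_mul_le_of_hasDeriv (c := -c) hst (fun x hx => (hf x hx).neg)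
    (fun x hx => by linarith [h x hx])
  simp only [Pi.neg_apply] at this
  linarith

lemma hasDerivWithinAt_Ici_of_Icc {x d : ℝ} (hx : x ∈ Ico s t)
    (h : HasDerivWithinAt f d (Icc s t) x) : HasDerivWithinAt f d (Ici x) x :=
  h.mono_of_mem_nhdsWithin
    (mem_of_superset (Icc_mem_nhdsGE hx.2) (Icc_subset_Icc_left hx.1))

/-- A function cannot cross a barrier upwards where its derivative is smaller. -/
lemma le_barrier {B B' : ℝ → ℝ} (hst : s ≤ t)
    (hf : ∀ x ∈ Icc s t, HasDerivWithinAt f (f' x) (Icc s t) x)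
    (hB : ∀ x ∈ Icc s t, HasDerivWithinAt B (B' x) (Icc s t) x) (h0 : f s ≤ B s)
    (h : ∀ x ∈ Ico s t, f x = B x → f' x < B' x) : f t ≤ B t :=
  image_le_of_deriv_right_lt_deriv_boundary' (fun x hx => (hf x hx).continuousWithinAt)
    (fun x hx => hasDerivWithinAt_Ici_of_Icc hx (hf x (Ico_subset_Icc_self hx))) h0
    (fun x hx => (hB x hx).continuousWithinAt)
    (fun x hx => hasDerivWithinAt_Ici_of_Icc hx (hB x (Ico_subset_Icc_self hx))) h
    (right_mem_Icc.2 hst)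

/-- Nonnegativity propagates under a linear differential inequality. -/
lemma nonneg_of_linear {a : ℝ → ℝ} (hst : s ≤ t)
    (hf : ∀ x ∈ Icc s t, HasDerivWithinAt f (f' x) (Icc s t) x)
    (ha : ContinuousOn a (Icc s t)) (h0 : 0 ≤ f s)
    (h : ∀ x ∈ Icc s t, f x < 0 → a x * f x ≤ f' x) : 0 ≤ f t := by
  obtain ⟨K, hK⟩ := isCompact_Icc.exists_bound_of_continuousOn ha
  -- The barrier grows at rate `K + 1`, where `K` bounds `|a|`; the extra `1` makes the comparison
  -- strict, and `ε` is arbitrary.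
  have key : ∀ ε > 0, -f t ≤ ε * Real.exp ((K + 1) * (t - s)) := by
    intro ε hε
    refine le_barrier (f := fun x => -f x) (f' := fun x => -f' x)
      (B := fun x => ε * Real.exp ((K + 1) * (x - s)))
      (B' := fun x => ε * (Real.exp ((K + 1) * (x - s)) * ((K + 1) * 1)))
      hst (fun x hx => (hf x hx).neg) (fun x hx => ?_) ?_ fun x hx hfx => ?_
    · exact ((((hasDerivWithinAt_id x _).sub_const s).const_mul (K + 1)).exp).const_mul ε
    · simp; linarith
    · have hp : 0 < ε * Real.exp ((K + 1) * (x - s)) := by positivity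
      have h1 := h x (Ico_subset_Icc_self hx) (by linarith)
      have h2 := mul_le_mul_of_nonneg_right (abs_le.1 (hK x (Ico_subset_Icc_self hx))).2 hp.le
      have h3 : f x = -(ε * Real.exp ((K + 1) * (x - s))) := by linarith
      rw [h3] at h1
      linarith
  by_contra hneg
  push Not at hneg
  have hp := Real.exp_pos ((K + 1) * (t - s))
  have := key (-f t / (2 * Real.exp ((K + 1) * (t - s)))) (by apply div_pos <;> linarith)
  have e : -f t / (2 * Real.exp ((K + 1) * (t - s))) * Real.exp ((K + 1) * (t - s)) = -f t / 2 := by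
    field_simp
  rw [e] at this
  linarith

lemma eq_zero_of_linear {a : ℝ → ℝ} (hst : s ≤ t)
    (hf : ∀ x ∈ Icc s t, HasDerivWithinAt f (f' x) (Icc s t) x)
    (ha : ContinuousOn a (Icc s t)) (h0 : f s = 0)
    (h : ∀ x ∈ Icc s t, f' x = a x * f x) : f t = 0 := by
  have h1 := nonneg_of_linear hst hf ha h0.ge (fun x hx _ => (h x hx).ge)
  have h2 := nonneg_of_linear (f := fun x => -f x) (f' := fun x => -f' x) hst
    (fun x hx => (hf x hx).neg) ha (by simp [h0]) (fun x hx _ => by simp [h x hx])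
  linarith

/-- Positivity propagates under a linear differential inequality, which needs to be known only as
long as positivity holds. -/
lemma pos_of_linear {a : ℝ → ℝ} (hst : s ≤ t)
    (hf : ∀ x ∈ Icc s t, HasDerivWithinAt f (f' x) (Icc s t) x)
    (ha : ContinuousOn a (Icc s t)) (h0 : 0 < f s)
    (h : ∀ x ∈ Icc s t, (∀ y ∈ Icc s x, 0 < f y) → a x * f x ≤ f' x) : 0 < f t := by
  by_contra hneg
  push Not at hneg
  have hc : ContinuousOn f (Icc s t) := fun x hx => (hf x hx).continuousWithinAt
  -- The least point `c` of `S` is the first zero. On `[s, c)` the function `f x * exp (K (x - s))`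
  -- is nondecreasing, so at `c` it is still at least `f s > 0`.
  set S := {x ∈ Icc s t | f x ≤ 0} with hS
  have hScl : IsCompact S := by
    have : S = Icc s t ∩ f ⁻¹' Iic 0 := rfl
    rw [this]
    exact isCompact_Icc.of_isClosed_subset (hc.preimage_isClosed_of_isClosed isClosed_Icc isClosed_Iic)
      inter_subset_left
  obtain ⟨c, hcS, hcmin⟩ := hScl.exists_isLeast ⟨t, right_mem_Icc.2 hst, hneg⟩
  have hpos : ∀ x ∈ Ico s c, 0 < f x := fun x hx => by
    by_contra hx0
    exact absurd (hcmin ⟨⟨hx.1, hx.2.le.trans hcS.1.2⟩, not_lt.1 hx0⟩) (not_le.2 hx.2)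
  obtain ⟨K, hK⟩ := isCompact_Icc.exists_bound_of_continuousOn ha
  have hsc : s < c := lt_of_le_of_ne hcS.1.1 (by rintro rfl; linarith [hcS.2])
  have hsub : Icc s c ⊆ Icc s t := Icc_subset_Icc_right hcS.1.2
  have key : ∀ d ∈ Ico s c, f s ≤ f d * Real.exp (K * (d - s)) := by
    intro d hd
    have hsub' : Icc s d ⊆ Icc s t := Icc_subset_Icc_right (hd.2.le.trans hcS.1.2)
    have := le_of_hasDeriv_nonneg (f := fun x => f x * Real.exp (K * (x - s)))
      (f' := fun x => f' x * Real.exp (K * (x - s)) + f x * (Real.exp (K * (x - s)) * (K * 1)))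
      hd.1 (fun x hx => ((hf x (hsub' hx)).mono hsub').mul
        ((((hasDerivWithinAt_id x _).sub_const s).const_mul K).exp)) (fun x hx => ?_)
    · simpa using this
    · have hx' : x < c := lt_of_le_of_lt hx.2 hd.2
      have h1 := h x (hsub' hx) (fun y hy => hpos y ⟨hy.1, lt_of_le_of_lt hy.2 hx'⟩)
      have h2 := (abs_le.1 (hK x (hsub' hx))).1
      have h3 := hpos x ⟨hx.1, hx'⟩
      have : 0 ≤ f' x + K * f x := by nlinarith
      have := mul_nonneg this (Real.exp_pos (K * (x - s))).le
      linarith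
  have hlim : Tendsto (fun d => f d * Real.exp (K * (d - s))) (𝓝[Ico s c] c)
      (𝓝 (f c * Real.exp (K * (c - s)))) := by
    refine Tendsto.mul ((hc c hcS.1).mono (Ico_subset_Icc_self.trans hsub)) ?_
    exact (Continuous.tendsto (by fun_prop) c).mono_left nhdsWithin_le_nhds
  have : (𝓝[Ico s c] c).NeBot := by
    rw [← mem_closure_iff_nhdsWithin_neBot, closure_Ico hsc.ne]; exact right_mem_Icc.2 hsc.le
  have h1 := ge_of_tendsto hlim (eventually_mem_nhdsWithin.mono key)
  nlinarith [hcS.2, Real.exp_pos (K * (c - s))]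

end Calculus

/-! ### Limits at infinity from differential inequalities. -/

section Asymptotics

variable {f f' g F F' : ℝ → ℝ} {T : ℝ}

lemma hasDerivWithinAt_Icc_of_le (hf : ∀ x, T ≤ x → HasDerivAt f (f' x) x) {s t : ℝ} (hs : T ≤ s) :
    ∀ x ∈ Icc s t, HasDerivWithinAt f (f' x) (Icc s t) x :=
  fun x hx => (hf x (hs.trans hx.1)).hasDerivWithinAt

lemma tendsto_atTop_of_hasDeriv {c : ℝ} (hc : 0 < c) (hf : ∀ x, T ≤ x → HasDerivAt f (f' x) x)
    (h : ∀ᶠ x in atTop, c ≤ f' x) : Tendsto f atTop atTop := by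
  obtain ⟨M, hM⟩ := eventually_atTop.1 h
  set A := max T M
  refine tendsto_atTop_mono' atTop (f₁ := fun x => f A + c * (x - A)) ?_ ?_
  · filter_upwards [eventually_ge_atTop A] with x hx
    exact add_mul_le_of_hasDeriv hx (hasDerivWithinAt_Icc_of_le hf (le_max_left T M))
      (fun y hy => hM y ((le_max_right T M).trans hy.1))
  · exact tendsto_atTop_add_const_left _ _
      ((tendsto_atTop_add_const_right atTop (-A) tendsto_id).const_mul_atTop hc)

lemma tendsto_atBot_of_hasDeriv {c : ℝ} (hc : 0 < c) (hf : ∀ x, T ≤ x → HasDerivAt f (f' x) x)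
    (h : ∀ᶠ x in atTop, f' x ≤ -c) : Tendsto f atTop atBot := by
  have := tendsto_atTop_of_hasDeriv (f := fun x => -f x) hc (fun x hx => (hf x hx).neg)
    (h.mono fun x hx => by linarith)
  simpa [Function.comp_def] using tendsto_neg_atTop_atBot.comp this

/-- If a function and its derivative converge, the derivative converges to zero. -/
lemma deriv_limit_eq_zero {l c : ℝ} (hf : ∀ x, T ≤ x → HasDerivAt f (f' x) x)
    (hl : Tendsto f atTop (𝓝 l)) (hc : Tendsto f' atTop (𝓝 c)) : c = 0 := by
  rcases lt_trichotomy c 0 with h | h | h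
  · have := tendsto_atBot_of_hasDeriv (c := -c / 2) (by linarith) hf
      (hc.eventually_le_const (by linarith))
    exact absurd hl (not_tendsto_nhds_of_tendsto_atBot this l)
  · exact h
  · have := tendsto_atTop_of_hasDeriv (c := c / 2) (by linarith) hf
      (hc.eventually_const_le (by linarith))
    exact absurd hl (not_tendsto_nhds_of_tendsto_atTop this l)

/-- A function that is eventually monotone and bounded above converges. -/
lemma exists_tendsto_of_deriv_nonneg {C : ℝ} (hf : ∀ x, T ≤ x → HasDerivAt f (f' x) x)
    (h : ∀ x, T ≤ x → 0 ≤ f' x) (hb : ∀ x, T ≤ x → f x ≤ C) : ∃ l, Tendsto f atTop (𝓝 l) := by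
  have hm : Monotone fun x => f (max x T) := fun x y hxy =>
    le_of_hasDeriv_nonneg (max_le_max_right T hxy)
      (hasDerivWithinAt_Icc_of_le hf (le_max_right x T))
      (fun z hz => h z ((le_max_right x T).trans hz.1))
  have hbd : BddAbove (range fun x => f (max x T)) :=
    ⟨C, by rintro _ ⟨x, rfl⟩; exact hb _ (le_max_right x T)⟩
  refine ⟨_, (tendsto_atTop_ciSup hm hbd).congr' ?_⟩
  filter_upwards [eventually_ge_atTop T] with x hx
  rw [max_eq_left hx]

lemma exists_tendsto_of_deriv_nonpos {C : ℝ} (hf : ∀ x, T ≤ x → HasDerivAt f (f' x) x)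
    (h : ∀ x, T ≤ x → f' x ≤ 0) (hb : ∀ x, T ≤ x → C ≤ f x) : ∃ l, Tendsto f atTop (𝓝 l) := by
  obtain ⟨l, hl⟩ := exists_tendsto_of_deriv_nonneg (f := fun x => -f x) (C := -C)
    (fun x hx => (hf x hx).neg) (fun x hx => by linarith [h x hx])
    (fun x hx => by linarith [hb x hx])
  exact ⟨-l, by simpa using hl.neg⟩

/-- A one-sided form of Barbalat's lemma. -/
lemma tendsto_zero_of_barbalat {C l : ℝ} (hF : ∀ x, T ≤ x → HasDerivAt F (F' x) x)
    (hf : ∀ x, T ≤ x → HasDerivAt f (f' x) x) (h0 : ∀ x, T ≤ x → 0 ≤ f x)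
    (hFf : ∀ x, T ≤ x → f x ≤ F' x) (hC : ∀ x, T ≤ x → -C ≤ f' x)
    (hl : Tendsto F atTop (𝓝 l)) : Tendsto f atTop (𝓝 0) := by
  rw [Metric.tendsto_atTop]
  intro ε hε
  set D := |C| + 1
  have hD : 0 < D := by positivity
  have hCD : C ≤ D := (le_abs_self C).trans (by simp [D])
  -- If `f x ≥ ε`, then `f` stays above `ε / 2` for a time `δ`, because `f' ≥ -D`. So `F` gains `δ ε
  -- / 2` on `[x, x + δ]`, which convergence of `F` excludes for late `x`.
  set δ := ε / (2 * D) with hδ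
  have hδ0 : 0 < δ := by positivity
  have hdiff : Tendsto (fun x => F (x + δ) - F x) atTop (𝓝 0) := by
    simpa using (hl.comp (tendsto_atTop_add_const_right atTop δ tendsto_id)).sub hl
  obtain ⟨M, hM⟩ := eventually_atTop.1 (hdiff.eventually_lt_const (show 0 < δ * (ε / 2) by positivity))
  refine ⟨max T M, fun x hx => ?_⟩
  have hTx : T ≤ x := (le_max_left T M).trans hx
  rw [Real.dist_eq, sub_zero, abs_of_nonneg (h0 x hTx)]
  by_contra hge
  push Not at hge
  have hlow : ∀ y ∈ Icc x (x + δ), ε / 2 ≤ F' y := by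
    intro y hy
    have h1 := add_mul_le_of_hasDeriv (c := -D) hy.1 (hasDerivWithinAt_Icc_of_le hf hTx)
      (fun z hz => by linarith [hC z (hTx.trans hz.1)])
    have h2 : D * (y - x) ≤ D * δ := by
      apply mul_le_mul_of_nonneg_left _ hD.le
      linarith [hy.2]
    have h3 : D * δ = ε / 2 := by rw [hδ]; field_simp
    linarith [hFf y (hTx.trans hy.1)]
  have := add_mul_le_of_hasDeriv (by linarith : x ≤ x + δ) (hasDerivWithinAt_Icc_of_le hF hTx) hlow
  have := hM x ((le_max_right T M).trans hx)
  nlinarith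

/-- Solutions of `h' ≤ -h + δ` with `h ≥ 0` and `δ → 0` tend to zero. -/
lemma tendsto_zero_of_deriv_le {δ : ℝ → ℝ} (hf : ∀ x, T ≤ x → HasDerivAt f (f' x) x)
    (h0 : ∀ x, T ≤ x → 0 ≤ f x) (h : ∀ x, T ≤ x → f' x ≤ -f x + δ x)
    (hδ : Tendsto δ atTop (𝓝 0)) : Tendsto f atTop (𝓝 0) := by
  rw [Metric.tendsto_atTop]
  intro ε hε
  obtain ⟨M, hM⟩ := eventually_atTop.1 (hδ.eventually_lt_const (show 0 < ε / 2 by positivity))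
  set A := max T M
  have hTA : T ≤ A := le_max_left T M
  have hb : ∀ x, A ≤ x → f x ≤ ε / 2 + f A * Real.exp (-(x - A)) := by
    intro x hx
    have := le_of_hasDeriv_nonpos (f := fun x => (f x - ε / 2) * Real.exp (x - A))
      (f' := fun x => f' x * Real.exp (x - A) + (f x - ε / 2) * (Real.exp (x - A) * 1)) hx
      (fun y hy => ((hf y (hTA.trans hy.1)).hasDerivWithinAt.sub_const _).mul
        (((hasDerivWithinAt_id y _).sub_const A).exp)) (fun y hy => ?_)
    · have e : Real.exp (x - A) * Real.exp (-(x - A)) = 1 := by rw [← Real.exp_add]; simp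
      simp only [sub_self, Real.exp_zero, mul_one] at this
      have h2 := mul_le_mul_of_nonneg_right this (Real.exp_pos (-(x - A))).le
      rw [mul_assoc, e] at h2
      nlinarith [Real.exp_pos (-(x - A))]
    · have h1 := h y (hTA.trans hy.1)
      have h2 := hM y ((le_max_right T M).trans hy.1)
      have := mul_nonneg (show 0 ≤ -(f' y + (f y - ε / 2)) by linarith) (Real.exp_pos (y - A)).le
      linarith
  have hexp : Tendsto (fun x => f A * Real.exp (-(x - A))) atTop (𝓝 (f A * 0)) :=
    (Real.tendsto_exp_neg_atTop_nhds_zero.comp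
      (tendsto_atTop_add_const_right atTop (-A) tendsto_id)).const_mul _
  rw [mul_zero] at hexp
  obtain ⟨M', hM'⟩ := eventually_atTop.1 (hexp.eventually_lt_const (show 0 < ε / 2 by positivity))
  refine ⟨max A M', fun x hx => ?_⟩
  have hAx : A ≤ x := (le_max_left _ _).trans hx
  rw [Real.dist_eq, sub_zero, abs_of_nonneg (h0 x (hTA.trans hAx))]
  linarith [hb x hAx, hM' x ((le_max_right _ _).trans hx)]

/-- Nonnegative solutions of `f' = g - f²` with `g → 1` tend to `1`. -/
lemma tendsto_one_of_riccati (hf : ∀ x, T ≤ x → HasDerivAt f (g x - f x ^ 2) x)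
    (h0 : ∀ x, T ≤ x → 0 ≤ f x) (hg : Tendsto g atTop (𝓝 1)) : Tendsto f atTop (𝓝 1) := by
  have h1 : Tendsto (fun x => (f x - 1) ^ 2) atTop (𝓝 0) := by
    -- With `h = (f - 1)²`, `h' = 2(f - 1)(g - 1) - 2(f + 1)h ≤ -h + (g - 1)²`, using `f ≥ 0` and
    -- Young's inequality.
    refine tendsto_zero_of_deriv_le (T := T) (δ := fun x => (g x - 1) ^ 2)
      (fun x hx => ((hf x hx).sub_const 1).pow 2) (fun x _ => sq_nonneg _) (fun x hx => ?_) ?_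
    · have := h0 x hx
      simp only [Nat.cast_ofNat, Nat.add_one_sub_one, pow_one]
      nlinarith [sq_nonneg (f x - 1 - (g x - 1)), mul_nonneg this (sq_nonneg (f x - 1))]
    · simpa using (hg.sub_const 1).pow 2
  have h2 : Tendsto (fun x => f x - 1) atTop (𝓝 0) := by
    have := h1.sqrt
    simp only [Real.sqrt_sq_eq_abs, Real.sqrt_zero] at this
    exact (tendsto_zero_iff_abs_tendsto_zero _).2 this
  simpa using h2.add_const 1

/-- A convergent square of an eventually differentiable function forces convergence of the function
up to a constant sign. -/
lemma tendsto_of_sq_tendsto {l : ℝ} (hf : ∀ x, T ≤ x → ContinuousAt f x)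
    (hl : Tendsto (fun x => f x ^ 2) atTop (𝓝 l)) :
    Tendsto f atTop (𝓝 (√l)) ∨ Tendsto f atTop (𝓝 (-√l)) := by
  have habs : Tendsto (fun x => |f x|) atTop (𝓝 (√l)) := by
    simpa [Real.sqrt_sq_eq_abs] using hl.sqrt
  have hl0 : 0 ≤ l := ge_of_tendsto' hl fun x => sq_nonneg _
  rcases hl0.eq_or_lt with rfl | hpos
  · left
    rw [Real.sqrt_zero] at habs ⊢
    exact (tendsto_zero_iff_abs_tendsto_zero _).2 habs
  obtain ⟨M, hM⟩ := eventually_atTop.1 (habs.eventually_const_lt (Real.sqrt_pos.2 hpos))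
  set A := max T M
  have hne : ∀ x ∈ Ici A, f x ≠ 0 := fun x hx h0 => by
    have := hM x ((le_max_right T M).trans hx)
    simp [h0] at this
  have hc : ContinuousOn f (Ici A) := fun x hx =>
    (hf x ((le_max_left T M).trans hx)).continuousWithinAt
  rcases isPreconnected_Ici.mapsTo_Ioi_or_Iio hc hne with h | h
  · left
    refine habs.congr' ?_
    filter_upwards [eventually_ge_atTop A] with x hx
    exact abs_of_pos (h hx)
  · right
    refine habs.neg.congr' ?_
    filter_upwards [eventually_ge_atTop A] with x hx
    rw [abs_of_neg (h hx), neg_neg]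

end Asymptotics

end HauntedEYM

/-! ### The constraint, signs and one-sided bounds. -/

namespace HauntedEYM

open Set

section Intervals

variable {b : EReal} {s t x : ℝ}

lemma Icc_subset_forwardInterval (hs : 0 ≤ s) (ht : t ∈ forwardInterval b) :
    Icc s t ⊆ forwardInterval b :=
  fun _ hx => ⟨hs.trans hx.1, lt_of_le_of_lt (EReal.coe_le_coe_iff.2 hx.2) ht.2⟩

lemma zero_mem_forwardInterval (hb : 0 < b) : (0 : ℝ) ∈ forwardInterval b :=
  ⟨le_rfl, by simpa using hb⟩

lemma forwardInterval_coe (c : ℝ) : forwardInterval (c : EReal) = Ico 0 c := by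
  ext x; simp [forwardInterval]

lemma forwardInterval_mem_nhds (hx : x ∈ forwardInterval b) (h0 : 0 < x) :
    forwardInterval b ∈ 𝓝 x := by
  have h1 : {ρ : ℝ | (ρ : EReal) < b} ∈ 𝓝 x :=
    (isOpen_Iio.preimage continuous_coe_real_ereal).mem_nhds hx.2
  filter_upwards [h1, Ioi_mem_nhds h0] with ρ hρ hρ0 using ⟨le_of_lt hρ0, hρ⟩

/-- A version of `nonneg_of_linear` on `[0, b)`. -/
lemma nonneg_of_linear_forward {f f' a : ℝ → ℝ} (hs : s ∈ forwardInterval b) (hst : s ≤ t)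
    (ht : t ∈ forwardInterval b)
    (hf : ∀ x ∈ forwardInterval b, HasDerivWithinAt f (f' x) (forwardInterval b) x)
    (ha : ContinuousOn a (forwardInterval b)) (h0 : 0 ≤ f s)
    (hle : ∀ x ∈ forwardInterval b, s ≤ x → f x < 0 → a x * f x ≤ f' x) : 0 ≤ f t := by
  have hI := Icc_subset_forwardInterval hs.1 ht
  exact nonneg_of_linear hst (fun x hx => (hf x (hI hx)).mono hI) (ha.mono hI) h0
    (fun x hx hx0 => hle x (hI hx) hx.1 hx0)

end Intervals

namespace Variables

variable (y : Variables)

/-- The Yang-Mills potential energy density `(1 - w²)² / r²`. -/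
noncomputable def V (ρ : ℝ) : ℝ := (1 - y.w ρ ^ 2) ^ 2 / y.r ρ ^ 2

/-- The energy `2 ẇ² - (1 - w²)²` of the Yang-Mills field. -/
noncomputable def energy (ρ : ℝ) : ℝ := 2 * (y.r ρ * y.U ρ) ^ 2 - (1 - y.w ρ ^ 2) ^ 2

lemma V_nonneg (ρ : ℝ) : 0 ≤ y.V ρ := by unfold V; positivity

/-- The reflected configuration, with the opposite Yang-Mills potential. -/
def reflect : Variables := { y with w := fun ρ => -y.w ρ, U := fun ρ => -y.U ρ }

end Variables

namespace IsSolutionOn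

variable {r₀ w₀ U₀ : ℝ} {b : EReal} {y : Variables} {ρ s t : ℝ}

lemma reflect (h : IsSolutionOn r₀ w₀ U₀ b y) : IsSolutionOn r₀ (-w₀) (-U₀) b y.reflect where
  b_pos := h.b_pos
  r_pos := h.r_pos
  deriv_r := h.deriv_r
  deriv_N ρ hρ := by simpa [Variables.reflect] using h.deriv_N ρ hρ
  deriv_w ρ hρ := (h.deriv_w ρ hρ).neg.congr_deriv (by simp [Variables.reflect])
  deriv_U ρ hρ := by
    refine (h.deriv_U ρ hρ).neg.congr_deriv ?_
    simp only [Variables.reflect]; ring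
  deriv_κ ρ hρ := by simpa [Variables.reflect] using h.deriv_κ ρ hρ
  deriv_ζ := h.deriv_ζ
  init_r := h.init_r
  init_N := h.init_N
  init_w := by simp [Variables.reflect, h.init_w]
  init_U := by simp [Variables.reflect, h.init_U]
  init_κ := h.init_κ
  init_ζ := by simpa [Variables.reflect, initialEnergy] using h.init_ζ

variable (h : IsSolutionOn r₀ w₀ U₀ b y)
include h

lemma cont_r : ContinuousOn y.r (forwardInterval b) := fun x hx => (h.deriv_r x hx).continuousWithinAt
lemma cont_N : ContinuousOn y.N (forwardInterval b) := fun x hx => (h.deriv_N x hx).continuousWithinAt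
lemma cont_w : ContinuousOn y.w (forwardInterval b) := fun x hx => (h.deriv_w x hx).continuousWithinAt
lemma cont_κ : ContinuousOn y.κ (forwardInterval b) := fun x hx => (h.deriv_κ x hx).continuousWithinAt

/-- The derivative of the potential `V`. -/
lemma deriv_V (hρ : ρ ∈ forwardInterval b) :
    HasDerivWithinAt y.V (-4 * y.w ρ * (1 - y.w ρ ^ 2) * y.U ρ / y.r ρ - 2 * y.V ρ * y.N ρ)
      (forwardInterval b) ρ := by
  have hr := (h.r_pos ρ hρ).ne'
  have := ((((h.deriv_w ρ hρ).pow 2).const_sub 1).pow 2).div ((h.deriv_r ρ hρ).pow 2)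
    (pow_ne_zero 2 hr)
  refine this.congr_deriv ?_
  simp only [Variables.V, Pi.pow_apply]
  field_simp
  ring

/-- The second order equation for `w`. -/
lemma deriv_rU (hρ : ρ ∈ forwardInterval b) :
    HasDerivWithinAt (fun ρ => y.r ρ * y.U ρ)
      ((2 * y.N ρ - y.κ ρ) * (y.r ρ * y.U ρ) - y.w ρ * (1 - y.w ρ ^ 2)) (forwardInterval b) ρ := by
  have hr := (h.r_pos ρ hρ).ne'
  refine ((h.deriv_r ρ hρ).mul (h.deriv_U ρ hρ)).congr_deriv ?_
  field_simp
  ring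

/-- The sign of `2N - κ` decides everything: damping in the cylindrical regime (`N → 0`, `κ → 1`),
antidamping in the flat one (`N → 1`, `κ → 1`). -/
lemma deriv_energy (hρ : ρ ∈ forwardInterval b) :
    HasDerivWithinAt y.energy (4 * (2 * y.N ρ - y.κ ρ) * (y.r ρ * y.U ρ) ^ 2)
      (forwardInterval b) ρ := by
  refine ((((h.deriv_rU hρ).pow 2).const_mul 2).sub
    ((((h.deriv_w ρ hρ).pow 2).const_sub 1).pow 2)).congr_deriv ?_
  simp only [Pi.pow_apply]
  ring

/-- The Hamiltonian constraint. -/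
lemma constraint (hE : 0 ≤ initialEnergy r₀ w₀ U₀) (hρ : ρ ∈ forwardInterval b) :
    y.ζ ρ ^ 2 = 1 + 2 * y.U ρ ^ 2 - y.V ρ + y.N ρ ^ 2 - 2 * y.κ ρ * y.N ρ := by
  have hI := Icc_subset_forwardInterval le_rfl hρ
  -- The defect `d` of the constraint solves `d' = -2κd` and vanishes initially by the choice `ζ 0 =
  -- √E₀`.
  have := eq_zero_of_linear hρ.1 (a := fun x => -2 * y.κ x)
    (f := fun x => 1 + 2 * y.U x ^ 2 - y.V x + y.N x ^ 2 - 2 * y.κ x * y.N x - y.ζ x ^ 2)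
    (fun x hx => (((((((h.deriv_U x (hI hx)).pow 2).const_mul 2).const_add 1).sub
      (h.deriv_V (hI hx))).add ((h.deriv_N x (hI hx)).pow 2)).sub
      (((h.deriv_κ x (hI hx)).const_mul 2).mul (h.deriv_N x (hI hx)))).sub
      ((h.deriv_ζ x (hI hx)).pow 2) |>.mono hI) ((h.cont_κ.mono hI).const_smul (-2 : ℝ)) ?_ ?_
  · linarith
  · simp only [h.init_U, h.init_N, h.init_κ, h.init_ζ, Variables.V, h.init_w, h.init_r,
      Real.sq_sqrt hE]
    simp only [initialEnergy]
    ring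
  · intro x hx
    have hr := (h.r_pos x (hI hx)).ne'
    simp only [Variables.V, Nat.cast_ofNat, Nat.add_one_sub_one, pow_one]
    field_simp
    ring

/-- `ρ / (1 + ρ)` is a rational subsolution of `κ' = 1 - κ²`, taking the place of `tanh`. It yields
`κ ≥ 1/2` from `ρ = 1` on. -/
lemma le_κ (hρ : ρ ∈ forwardInterval b) : ρ / (1 + ρ) ≤ y.κ ρ := by
  have key : ∀ x ∈ forwardInterval b, HasDerivWithinAt (fun x => y.κ x - x / (1 + x))
      (1 + 2 * y.U x ^ 2 - y.κ x ^ 2 - 1 / (1 + x) ^ 2) (forwardInterval b) x := by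
    intro x hx
    have hx1 : 1 + x ≠ 0 := by linarith [hx.1]
    have := (h.deriv_κ x hx).sub ((hasDerivWithinAt_id x _).div
      ((hasDerivWithinAt_id x (forwardInterval b)).const_add 1) hx1)
    exact this.congr_deriv (by simp)
  have hc : ContinuousOn (fun x => -(y.κ x + x / (1 + x))) (forwardInterval b) := by
    refine (h.cont_κ.add (continuousOn_id.div (continuousOn_const.add continuousOn_id) ?_)).neg
    intro x hx
    exact (show (1 : ℝ) + x ≠ 0 by linarith [hx.1])
  have := nonneg_of_linear_forward (zero_mem_forwardInterval h.b_pos) hρ.1 hρ key hc (by simp [h.init_κ]) ?_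
  · linarith
  · intro x hx _ _
    have hx0 : 0 < 1 + x := by linarith [hx.1]
    have e : 1 - (x / (1 + x)) ^ 2 - 1 / (1 + x) ^ 2 = 2 * x / (1 + x) ^ 2 := by
      field_simp; ring
    have : 0 ≤ 2 * x / (1 + x) ^ 2 := by have := hx.1; positivity
    nlinarith [sq_nonneg (y.U x)]

lemma κ_nonneg (hρ : ρ ∈ forwardInterval b) : 0 ≤ y.κ ρ :=
  le_trans (by have := hρ.1; positivity) (h.le_κ hρ)

lemma half_le_κ (hρ : ρ ∈ forwardInterval b) (h1 : 1 ≤ ρ) : 1 / 2 ≤ y.κ ρ := by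
  refine le_trans ?_ (h.le_κ hρ)
  rw [div_le_div_iff₀] <;> linarith

lemma deriv_κ_sub_N (hρ : ρ ∈ forwardInterval b) :
    HasDerivWithinAt (fun ρ => y.κ ρ - y.N ρ)
      (2 * y.U ρ ^ 2 + y.V ρ - y.κ ρ * (y.κ ρ - y.N ρ)) (forwardInterval b) ρ := by
  refine ((h.deriv_κ ρ hρ).sub (h.deriv_N ρ hρ)).congr_deriv ?_
  simp only [Variables.V]; ring

lemma N_le_κ (hρ : ρ ∈ forwardInterval b) : y.N ρ ≤ y.κ ρ := by
  have := nonneg_of_linear_forward (zero_mem_forwardInterval h.b_pos) hρ.1 hρ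
    (fun x hx => h.deriv_κ_sub_N hx) h.cont_κ.neg (by simp [h.init_κ, h.init_N])
    (fun x hx _ _ => by simp only [Pi.neg_apply]; nlinarith [sq_nonneg (y.U x), y.V_nonneg x])
  linarith

/-- Eliminating `V` by the constraint exposes the Riccati term `-N²`, the source of all lower bounds
on `N`. -/
lemma N'_eq (hE : 0 ≤ initialEnergy r₀ w₀ U₀) (hρ : ρ ∈ forwardInterval b) :
    1 - (1 - y.w ρ ^ 2) ^ 2 / y.r ρ ^ 2 - y.κ ρ * y.N ρ =
      (y.κ ρ - y.N ρ) * y.N ρ + y.ζ ρ ^ 2 - 2 * y.U ρ ^ 2 := by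
  have := h.constraint hE hρ
  simp only [Variables.V] at this
  linarith

lemma ζ_nonneg (hρ : ρ ∈ forwardInterval b) : 0 ≤ y.ζ ρ :=
  nonneg_of_linear_forward (zero_mem_forwardInterval h.b_pos) hρ.1 hρ h.deriv_ζ h.cont_κ.neg
    (by simp [h.init_ζ]) (fun _ _ _ _ => le_rfl)

lemma ζ_le (hρ : ρ ∈ forwardInterval b) : y.ζ ρ ≤ y.ζ 0 := by
  have hI := Icc_subset_forwardInterval le_rfl hρ
  exact le_of_hasDeriv_nonpos hρ.1 (fun x hx => (h.deriv_ζ x (hI hx)).mono hI)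
    (fun x hx => by nlinarith [h.κ_nonneg (hI hx), h.ζ_nonneg (hI hx)])

lemma ζ_zero_nonneg : 0 ≤ y.ζ 0 := h.ζ_nonneg (zero_mem_forwardInterval h.b_pos)

lemma ζ_sq_le (hρ : ρ ∈ forwardInterval b) : y.ζ ρ ^ 2 ≤ y.ζ 0 ^ 2 :=
  pow_le_pow_left₀ (h.ζ_nonneg hρ) (h.ζ_le hρ) 2

/-- By the constraint `(κ + N)' = 1 + ζ² - ((κ + N)² + 3(κ - N)²) / 4`, which is negative when `κ +
N = 2(2 + ζ 0)`. -/
lemma κ_add_N_le (hE : 0 ≤ initialEnergy r₀ w₀ U₀) (hρ : ρ ∈ forwardInterval b) :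
    y.κ ρ + y.N ρ ≤ 2 * (2 + y.ζ 0) := by
  have hI := Icc_subset_forwardInterval le_rfl hρ
  refine le_barrier (f := fun x => y.κ x + y.N x) (B := fun _ => 2 * (2 + y.ζ 0))
    (B' := fun _ => 0) hρ.1
    (fun x hx => ((h.deriv_κ x (hI hx)).add (h.deriv_N x (hI hx))).mono hI)
    (fun x hx => hasDerivWithinAt_const _ _ _) ?_ fun x hx hxe => ?_
  · simp only [h.init_κ, h.init_N]; linarith [h.ζ_zero_nonneg]
  · have hx' := hI (Ico_subset_Icc_self hx)
    have h1 := h.constraint hE hx'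
    have h2 := h.ζ_sq_le hx'
    have h3 := h.ζ_zero_nonneg
    simp only [Variables.V] at h1
    have h4 : (y.κ x + y.N x) ^ 2 = (2 * (2 + y.ζ 0)) ^ 2 := by rw [hxe]
    nlinarith [sq_nonneg (y.κ x - y.N x)]

lemma N_le (hE : 0 ≤ initialEnergy r₀ w₀ U₀) (hρ : ρ ∈ forwardInterval b) :
    y.N ρ ≤ 2 + y.ζ 0 := by
  linarith [h.κ_add_N_le hE hρ, h.N_le_κ hρ]

/-- For `N < 0`, averaging the two expressions for `N'` (with and without `V`) cancels `κN`. The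
surviving `-V / 2` is what later absorbs the growth of `U`. -/
lemma N'_le (hE : 0 ≤ initialEnergy r₀ w₀ U₀) (hρ : ρ ∈ forwardInterval b) :
    1 - (1 - y.w ρ ^ 2) ^ 2 / y.r ρ ^ 2 - y.κ ρ * y.N ρ ≤ 1 + y.ζ 0 ^ 2 / 2 - y.V ρ / 2 := by
  have h1 := h.constraint hE hρ
  have h2 := h.ζ_sq_le hρ
  have h3 := y.V_nonneg ρ
  have h4 := h.κ_nonneg hρ
  have h5 : y.V ρ = (1 - y.w ρ ^ 2) ^ 2 / y.r ρ ^ 2 := rfl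
  rw [← h5]
  rcases le_total 0 (y.N ρ) with hN | hN
  · nlinarith [mul_nonneg h4 hN, sq_nonneg (y.ζ 0)]
  · nlinarith [sq_nonneg (y.N ρ), sq_nonneg (y.U ρ)]

/-- If `w` exceeds `1` somewhere, it eventually increases away from `1`. -/
lemma exists_w_gt (hw : |w₀| ≤ 1) (hρ : ρ ∈ forwardInterval b) (h1 : 1 < y.w ρ) :
    ∃ s ∈ forwardInterval b, 0 < s ∧ 1 < y.w s ∧
      ∀ t ∈ forwardInterval b, s ≤ t → y.w s ≤ y.w t ∧ 0 < y.U t := by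
  -- Otherwise `U ≤ 0` wherever `w > 1`, and `w` could never have passed `1`.
  obtain ⟨s, hs, hws, hUs⟩ : ∃ s ∈ forwardInterval b, 1 < y.w s ∧ 0 < y.U s := by
    by_contra! hcon
    have := nonneg_of_linear_forward (f := fun x => 1 - y.w x) (a := fun _ => 0)
      (zero_mem_forwardInterval h.b_pos) hρ.1 hρ
      (fun x hx => (h.deriv_w x hx).const_sub 1) continuousOn_const
      (by simp only [h.init_w]; linarith [(abs_le.1 hw).2]) (fun x hx _ hx0 => ?_)
    · linarith
    · nlinarith [h.r_pos x hx, hcon x hx (by linarith)]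
  have hmono : ∀ t ∈ forwardInterval b, s ≤ t → (∀ x ∈ Icc s t, 0 < y.U x) → y.w s ≤ y.w t := by
    intro t ht hst hU
    have hI := Icc_subset_forwardInterval hs.1 ht
    exact le_of_hasDeriv_nonneg hst (fun x hx => (h.deriv_w x (hI hx)).mono hI)
      (fun x hx => (mul_pos (h.r_pos x (hI hx)) (hU x hx)).le)
  have hpos : ∀ t ∈ forwardInterval b, s ≤ t → 0 < y.U t := by
    intro t ht hst
    have hI := Icc_subset_forwardInterval hs.1 ht
    refine pos_of_linear (a := fun x => -(y.κ x - y.N x)) hst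
      (fun x hx => (h.deriv_U x (hI hx)).mono hI)
      (((h.cont_κ.sub h.cont_N).neg).mono hI) hUs fun x hx hU => ?_
    have hwx := hmono x (hI hx) hx.1 hU
    have : y.w x * (1 - y.w x ^ 2) / y.r x ≤ 0 :=
      div_nonpos_of_nonpos_of_nonneg (by nlinarith) (h.r_pos x (hI hx)).le
    linarith
  refine ⟨s, hs, lt_of_le_of_ne hs.1 ?_, hws, fun t ht hst => ⟨?_, hpos t ht hst⟩⟩
  · rintro rfl
    rw [h.init_w] at hws
    linarith [(abs_le.1 hw).2]
  · exact hmono t ht hst fun x hx =>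
      hpos x (Icc_subset_forwardInterval hs.1 ht hx) hx.1

end IsSolutionOn

end HauntedEYM

/-! ### Continuation of bounded solutions. -/

namespace HauntedEYM

open Set

/-- A bounded integral curve on `[0, c)`, staying in a closed set where the vector field is `C¹`,
can be continued beyond `c`. -/
lemma exists_extension_integralCurve {E : Type*} [NormedAddCommGroup E] [NormedSpace ℝ E]
    [CompleteSpace E] {F : E → E} {Y : ℝ → E} {c K : ℝ} (hc : 0 < c)
    (hY : ∀ x ∈ Ico 0 c, HasDerivWithinAt Y (F (Y x)) (Ico 0 c) x)
    (hK : ∀ x ∈ Ico 0 c, ‖F (Y x)‖ ≤ K) {S O : Set E} (hS : IsClosed S) (hO : IsOpen O)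
    (hSO : S ⊆ O) (hYS : ∀ x ∈ Ico 0 c, Y x ∈ S) (hF : ∀ p ∈ S, ContDiffAt ℝ 1 F p) :
    ∃ d > c, ∃ Z : ℝ → E, EqOn Y Z (Ico 0 c) ∧ ∀ x ∈ Ico 0 d,
      Z x ∈ O ∧ HasDerivWithinAt Z (F (Z x)) (Ico 0 d) x := by
  have hlip : LipschitzOnWith K.toNNReal Y (Ico 0 c) := by
    refine (convex_Ico 0 c).lipschitzOnWith_of_nnnorm_hasDerivWithin_le hY fun x hx => ?_
    rw [← NNReal.coe_le_coe, coe_nnnorm]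
    exact (hK x hx).trans (Real.le_coe_toNNReal K)
  have hnb : (𝓝[Ico 0 c] c).NeBot := by
    rw [← mem_closure_iff_nhdsWithin_neBot, closure_Ico hc.ne]; exact right_mem_Icc.2 hc.le
  obtain ⟨p, hp⟩ : ∃ p, Tendsto Y (𝓝[Ico 0 c] c) (𝓝 p) := by
    have hcau : Cauchy (𝓝[Ico 0 c] c) := cauchy_nhds.mono inf_le_left
    exact cauchy_map_iff_exists_tendsto.1
      (hcau.map_of_le hlip.uniformContinuousOn inf_le_right)
  have hpS : p ∈ S := hS.mem_of_tendsto hp (eventually_mem_nhdsWithin.mono hYS)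
  have hnhds : 𝓝[Ico 0 c] c = 𝓝[<] c := nhdsWithin_Ico_eq_nhdsLT hc
  obtain ⟨α, hα0, ε, hε, hα⟩ :=
    (hF p hpS).exists_forall_mem_closedBall_exists_eq_forall_mem_Ioo_hasDerivAt₀ c
  have hαc : ContinuousAt α c := (hα c ⟨by linarith, by linarith⟩).continuousAt
  obtain ⟨η, hη, hηO⟩ : ∃ η > 0, ∀ x, |x - c| < η → α x ∈ O := by
    have := hαc (by rw [hα0]; exact hO.mem_nhds (hSO hpS) : O ∈ 𝓝 (α c))
    obtain ⟨η, hη, h⟩ := Metric.mem_nhds_iff.1 this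
    exact ⟨η, hη, fun x hx => h (by simpa [Real.dist_eq] using hx)⟩
  -- `Y` has a limit `p` at `c` because its velocity is bounded, and `α` is the local solution
  -- through `p`. At the seam the left derivative is the limit of the derivatives of `Y`, the right
  -- one comes from `α`.
  set Z : ℝ → E := fun x => if x < c then Y x else α x with hZ
  have hZY : EqOn Y Z (Ico 0 c) := fun x hx => by simp [hZ, hx.2]
  have hZα : ∀ x, c ≤ x → Z x = α x := fun x hx => by simp [hZ, not_lt.2 hx]
  have hZc : Z c = p := by rw [hZα c le_rfl, hα0]
  have hder : ∀ x ∈ Ioo 0 c, HasDerivAt Z (F (Z x)) x := by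
    intro x hx
    have h1 : HasDerivAt Y (F (Y x)) x :=
      (hY x ⟨hx.1.le, hx.2⟩).hasDerivAt (Ico_mem_nhds hx.1 hx.2)
    rw [← hZY ⟨hx.1.le, hx.2⟩]
    refine h1.congr_of_eventuallyEq ?_
    filter_upwards [Ico_mem_nhds hx.1 hx.2] with z hz using (hZY hz).symm
  have hZlim : Tendsto Z (𝓝[<] c) (𝓝 p) := by
    rw [← hnhds]
    exact hp.congr' (eventually_mem_nhdsWithin.mono hZY)
  have hleft : HasDerivWithinAt Z (F p) (Iic c) c := by
    refine hasDerivWithinAt_Iic_of_tendsto_deriv (s := Ioo 0 c)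
      (fun x hx => (hder x hx).differentiableAt.differentiableWithinAt) ?_
      (Ioo_mem_nhdsLT hc) ?_
    · rw [ContinuousWithinAt, hZc]
      exact hZlim.mono_left (nhdsWithin_mono _ fun x hx => hx.2)
    · have h1 : Tendsto (fun x => F (Z x)) (𝓝[<] c) (𝓝 (F p)) :=
        (hF p hpS).continuousAt.tendsto.comp hZlim
      refine h1.congr' ?_
      filter_upwards [Ioo_mem_nhdsLT hc] with x hx using (hder x hx).deriv.symm
  have hright : HasDerivWithinAt Z (F p) (Ici c) c := by
    have h1 : HasDerivWithinAt α (F (α c)) (Ici c) c :=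
      (hα c ⟨by linarith, by linarith⟩).hasDerivWithinAt
    rw [hα0] at h1
    exact h1.congr (fun x hx => hZα x hx) (hZα c le_rfl)
  have hmid : HasDerivAt Z (F (Z c)) c := by
    rw [hZc]
    have := hleft.union hright
    rwa [Iic_union_Ici, hasDerivWithinAt_univ] at this
  refine ⟨c + min ε η, by have := lt_min hε hη; linarith, Z, hZY, fun x hx => ?_⟩
  rcases lt_trichotomy x c with hxc | rfl | hxc
  · refine ⟨by rw [← hZY ⟨hx.1, hxc⟩]; exact hSO (hYS x ⟨hx.1, hxc⟩), ?_⟩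
    have h1 := hY x ⟨hx.1, hxc⟩
    rw [hZY ⟨hx.1, hxc⟩] at h1
    have h2 := h1.congr (fun z hz => (hZY hz).symm) (hZY ⟨hx.1, hxc⟩).symm
    refine h2.mono_of_mem_nhdsWithin ?_
    rw [mem_nhdsWithin]
    exact ⟨Iio c, isOpen_Iio, hxc, fun z hz => ⟨hz.2.1, hz.1⟩⟩
  · exact ⟨by rw [hZc]; exact hSO hpS, hmid.hasDerivWithinAt⟩
  · have h1 : x < c + ε := lt_of_lt_of_le hx.2 (by linarith [min_le_left ε η])
    have h2 : x < c + η := lt_of_lt_of_le hx.2 (by linarith [min_le_right ε η])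
    refine ⟨?_, ?_⟩
    · rw [hZα x hxc.le]
      exact hηO x (by rw [abs_of_pos] <;> linarith)
    · have h3 := hα x ⟨by linarith, h1⟩
      rw [← hZα x hxc.le] at h3
      refine (h3.congr_of_eventuallyEq ?_).hasDerivWithinAt
      filter_upwards [Ioi_mem_nhds hxc] with z hz using hZα z (le_of_lt hz)

/-- The right hand side of the static Einstein-Yang-Mills-phantom system, for
`(r, N, w, U, κ, ζ)`. -/
noncomputable def vectorField (p : Fin 6 → ℝ) : Fin 6 → ℝ :=
  ![p 0 * p 1, 1 - (1 - p 2 ^ 2) ^ 2 / p 0 ^ 2 - p 4 * p 1, p 0 * p 3,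
    -(p 4 - p 1) * p 3 - p 2 * (1 - p 2 ^ 2) / p 0, 1 + 2 * p 3 ^ 2 - p 4 ^ 2, -p 4 * p 5]

lemma contDiffAt_vectorField {p : Fin 6 → ℝ} (hp : 0 < p 0) : ContDiffAt ℝ 1 vectorField p := by
  have h := hp.ne'
  have h2 := pow_ne_zero 2 h
  rw [contDiffAt_pi]
  intro i
  have hc : ∀ j : Fin 6, ContDiffAt ℝ 1 (fun p : Fin 6 → ℝ => p j) p := fun j =>
    (contDiff_apply ℝ ℝ j).contDiffAt
  fin_cases i
  · exact (hc 0).mul (hc 1)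
  · exact (contDiffAt_const.sub (((contDiffAt_const.sub ((hc 2).pow 2)).pow 2).div
      ((hc 0).pow 2) h2)).sub ((hc 4).mul (hc 1))
  · exact (hc 0).mul (hc 3)
  · exact (((hc 4).sub (hc 1)).neg.mul (hc 3)).sub
      (((hc 2).mul (contDiffAt_const.sub ((hc 2).pow 2))).div (hc 0) h)
  · exact (contDiffAt_const.add (contDiffAt_const.mul ((hc 3).pow 2))).sub ((hc 4).pow 2)
  · exact (hc 4).neg.mul (hc 5)

/-- The bounds confine the solution to a compact subset of `{r > 0}`, on which the vector field is
`C¹` and bounded. -/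
lemma IsSolutionOn.exists_extension {r₀ w₀ U₀ c : ℝ} {y : Variables}
    (h : IsSolutionOn r₀ w₀ U₀ (c : EReal) y) {C δ : ℝ} (hδ : 0 < δ)
    (hr : ∀ ρ ∈ forwardInterval (c : EReal), δ ≤ y.r ρ)
    (hC : ∀ ρ ∈ forwardInterval (c : EReal), |y.r ρ| ≤ C ∧ |y.N ρ| ≤ C ∧ |y.w ρ| ≤ C ∧
      |y.U ρ| ≤ C ∧ |y.κ ρ| ≤ C ∧ |y.ζ ρ| ≤ C) :
    ∃ (b : EReal) (y' : Variables), (c : EReal) < b ∧ IsSolutionOn r₀ w₀ U₀ b y' ∧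
      AgreeOn y y' (forwardInterval (c : EReal)) := by
  have hc : 0 < c := by exact_mod_cast h.b_pos
  rw [forwardInterval_coe] at hr hC ⊢
  set Y : ℝ → Fin 6 → ℝ := fun x => ![y.r x, y.N x, y.w x, y.U x, y.κ x, y.ζ x] with hYdef
  set S : Set (Fin 6 → ℝ) := {p | δ ≤ p 0} ∩ Metric.closedBall 0 (max C 0) with hSdef
  have hScompact : IsCompact S :=
    (isCompact_closedBall 0 (max C 0)).inter_left
      (isClosed_le continuous_const (continuous_apply 0))
  have hF : ∀ p ∈ S, ContDiffAt ℝ 1 vectorField p := fun p hp =>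
    contDiffAt_vectorField (hδ.trans_le hp.1)
  obtain ⟨K, hK⟩ := hScompact.exists_bound_of_continuousOn
    (fun p hp => (hF p hp).continuousAt.continuousWithinAt)
  have hYS : ∀ x ∈ Ico 0 c, Y x ∈ S := by
    intro x hx
    refine ⟨hr x hx, ?_⟩
    rw [mem_closedBall_zero_iff, pi_norm_le_iff_of_nonneg (le_max_right C 0)]
    obtain ⟨h1, h2, h3, h4, h5, h6⟩ := hC x hx
    intro i
    refine le_trans ?_ (le_max_left C 0)
    fin_cases i <;> simpa [hYdef]
  have hY : ∀ x ∈ Ico 0 c, HasDerivWithinAt Y (vectorField (Y x)) (Ico 0 c) x := by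
    intro x hx
    rw [← forwardInterval_coe] at hx ⊢
    rw [hasDerivWithinAt_pi]
    intro i
    fin_cases i
    · exact h.deriv_r x hx
    · exact h.deriv_N x hx
    · exact h.deriv_w x hx
    · exact h.deriv_U x hx
    · exact h.deriv_κ x hx
    · exact h.deriv_ζ x hx
  obtain ⟨d, hd, Z, hZY, hZ⟩ := exists_extension_integralCurve (O := {p | 0 < p 0}) hc hY
    (fun x hx => hK _ (hYS x hx)) hScompact.isClosed
    (isOpen_lt continuous_const (continuous_apply 0)) (fun p hp => hδ.trans_le hp.1) hYS hF
  have h0 := hZY ⟨le_rfl, hc⟩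
  have hZ' : ∀ x ∈ Ico 0 d, ∀ i, HasDerivWithinAt (fun z => Z z i) (vectorField (Z x) i)
      (Ico 0 d) x := fun x hx => hasDerivWithinAt_pi.1 (hZ x hx).2
  refine ⟨d, ⟨fun x => Z x 0, fun x => Z x 1, fun x => Z x 2, fun x => Z x 3, fun x => Z x 4,
    fun x => Z x 5⟩, by exact_mod_cast hd, ?_, ?_⟩
  · rw [← forwardInterval_coe] at hZ hZ'
    exact {
      b_pos := by exact_mod_cast hc.trans hd
      r_pos := fun x hx => (hZ x hx).1
      deriv_r := fun x hx => hZ' x hx 0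
      deriv_N := fun x hx => hZ' x hx 1
      deriv_w := fun x hx => hZ' x hx 2
      deriv_U := fun x hx => hZ' x hx 3
      deriv_κ := fun x hx => hZ' x hx 4
      deriv_ζ := fun x hx => hZ' x hx 5
      init_r := (congrFun h0 0).symm.trans h.init_r
      init_N := (congrFun h0 1).symm.trans h.init_N
      init_w := (congrFun h0 2).symm.trans h.init_w
      init_U := (congrFun h0 3).symm.trans h.init_U
      init_κ := (congrFun h0 4).symm.trans h.init_κ
      init_ζ := (congrFun h0 5).symm.trans h.init_ζ }
  · exact ⟨fun x hx => congrFun (hZY hx) 0, fun x hx => congrFun (hZY hx) 1,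
      fun x hx => congrFun (hZY hx) 2, fun x hx => congrFun (hZY hx) 3,
      fun x hx => congrFun (hZY hx) 4, fun x hx => congrFun (hZY hx) 5⟩

end HauntedEYM

/-! ### A priori bounds on finite intervals. -/

namespace HauntedEYM

open Set

namespace IsSolutionOn

/-- The force is `|w| √V`, and the constraint bounds `V` by a quadratic polynomial in `|U|` and the
negative part of `N`, with no factor `1 / r`. -/
lemma abs_force_le {r₀ w₀ U₀ : ℝ} {b : EReal} {y : Variables} (h : IsSolutionOn r₀ w₀ U₀ b y)
    (hE : 0 ≤ initialEnergy r₀ w₀ U₀) {W ρ : ℝ}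
    (hρ : ρ ∈ forwardInterval b) (hW : |y.w ρ| ≤ W) :
    |y.w ρ * (1 - y.w ρ ^ 2) / y.r ρ| ≤
      W * (1 + 2 * (2 + y.ζ 0) + 2 * max (-y.N ρ) 0 + 2 * |y.U ρ|) := by
  set n := max (-y.N ρ) 0 with hn
  have hn0 : 0 ≤ n := le_max_right _ _
  have hW0 : 0 ≤ W := (abs_nonneg _).trans hW
  have hζ := h.ζ_zero_nonneg
  have hV : y.V ρ ≤ (1 + 2 * (2 + y.ζ 0) + 2 * n + 2 * |y.U ρ|) ^ 2 := by
    have h1 := h.constraint hE hρ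
    have h2 := h.N_le hE hρ
    have h3 := h.κ_nonneg hρ
    have h4 := h.κ_add_N_le hE hρ
    have h5 := sq_abs (y.U ρ)
    have h6 := abs_nonneg (y.U ρ)
    have h7 : 0 ≤ n * |y.U ρ| := by positivity
    have h8 : 0 ≤ (y.ζ 0) * |y.U ρ| := by positivity
    have h9 : 0 ≤ (y.ζ 0) * n := by positivity
    rcases le_total 0 (y.N ρ) with hN | hN
    · nlinarith [mul_nonneg h3 hN, sq_nonneg (y.ζ ρ)]
    · have : n = -y.N ρ := max_eq_left (by linarith)
      nlinarith [sq_nonneg (y.ζ ρ), mul_le_mul_of_nonneg_right h4 hn0]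
  refine abs_le_of_sq_le_sq ?_ (by positivity)
  have e : (y.w ρ * (1 - y.w ρ ^ 2) / y.r ρ) ^ 2 = y.w ρ ^ 2 * y.V ρ := by
    simp only [Variables.V]; ring
  rw [e, mul_pow]
  exact mul_le_mul (sq_le_sq' (abs_le.1 hW).1 (abs_le.1 hW).2) hV (y.V_nonneg ρ) (sq_nonneg W)

section Finite

variable {r₀ w₀ U₀ c : ℝ} {y : Variables} (h : IsSolutionOn r₀ w₀ U₀ (c : EReal) y)
  (hE : 0 ≤ initialEnergy r₀ w₀ U₀)
include h hE

lemma exists_r_le : ∃ R, 1 ≤ R ∧ ∀ ρ ∈ forwardInterval (c : EReal), y.r ρ ≤ R := by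
  set M := 2 + y.ζ 0
  refine ⟨max 1 (r₀ * Real.exp (M * c)), le_max_left _ _, fun ρ hρ => le_trans ?_ (le_max_right _ _)⟩
  have hI := Icc_subset_forwardInterval le_rfl hρ
  have h0 := h.r_pos 0 (zero_mem_forwardInterval h.b_pos)
  rw [h.init_r] at h0
  have := le_of_hasDeriv_nonpos (f := fun x => y.r x * Real.exp (-M * x)) hρ.1
    (fun x hx => ((h.deriv_r x (hI hx)).mono hI).mul
      (((hasDerivWithinAt_id x _).const_mul (-M)).exp)) (fun x hx => ?_)
  · simp only [h.init_r, mul_zero, Real.exp_zero, mul_one, neg_mul, Real.exp_neg] at this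
    rw [← div_eq_mul_inv, div_le_iff₀ (Real.exp_pos _)] at this
    refine this.trans ?_
    have hρc : ρ ≤ c := by have := hρ.2; exact_mod_cast this.le
    have hM : 0 ≤ M := by have := h.ζ_zero_nonneg; positivity
    gcongr
  · have h1 := h.N_le hE (hI hx)
    have h2 := mul_nonneg (h.r_pos x (hI hx)).le (Real.exp_pos (-M * x)).le
    simp only [id, mul_one]
    nlinarith

omit hE in
lemma exists_le_r {M : ℝ} (hM : ∀ ρ ∈ forwardInterval (c : EReal), -M ≤ y.N ρ) :
    ∃ δ > 0, ∀ ρ ∈ forwardInterval (c : EReal), δ ≤ y.r ρ := by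
  have h0 := h.r_pos 0 (zero_mem_forwardInterval h.b_pos)
  rw [h.init_r] at h0
  refine ⟨r₀ * Real.exp (-|M| * c), by positivity, fun ρ hρ => ?_⟩
  have hI := Icc_subset_forwardInterval le_rfl hρ
  have := le_of_hasDeriv_nonneg (f := fun x => y.r x * Real.exp (|M| * x)) hρ.1
    (fun x hx => ((h.deriv_r x (hI hx)).mono hI).mul
      (((hasDerivWithinAt_id x _).const_mul |M|).exp)) (fun x hx => ?_)
  · simp only [h.init_r, mul_zero, Real.exp_zero, mul_one] at this
    have hρc : ρ ≤ c := by have := hρ.2; exact_mod_cast this.le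
    calc r₀ * Real.exp (-|M| * c) ≤ r₀ * Real.exp (-|M| * ρ) := by
          have := abs_nonneg M
          gcongr ?_ * ?_
          rw [Real.exp_le_exp]; nlinarith
      _ ≤ y.r ρ * Real.exp (|M| * ρ) * Real.exp (-|M| * ρ) := by gcongr
      _ = y.r ρ := by rw [mul_assoc, ← Real.exp_add]; simp
  · have h1 := hM x (hI hx)
    have h2 := mul_nonneg (h.r_pos x (hI hx)).le (Real.exp_pos (|M| * x)).le
    have h3 := le_abs_self M
    simp only [id, mul_one]
    nlinarith

/-- Beyond `w = 1` the force increases `U`, but `V` decreases `N` at a comparable rate. Hence `U +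
2RN` is bounded above, and `w + 2Rr`, whose derivative is `r(U + 2RN)`, is too. -/
lemma exists_w_le (hw : |w₀| ≤ 1) :
    ∃ W, ∀ ρ ∈ forwardInterval (c : EReal), y.w ρ ≤ W := by
  by_cases hex : ∃ ρ ∈ forwardInterval (c : EReal), 1 < y.w ρ
  swap
  · push Not at hex
    exact ⟨1, hex⟩
  obtain ⟨ρ, hρ, hρ1⟩ := hex
  obtain ⟨s, hs, -, hws, hfw⟩ := h.exists_w_gt hw hρ hρ1
  obtain ⟨R, hR1, hR⟩ := h.exists_r_le hE
  set K₁ := 2 * R * (1 + y.ζ 0 ^ 2 / 2) + 4 with hK₁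
  have hK₁0 : 0 ≤ K₁ := by positivity
  set K₂ := |y.U s + 2 * R * y.N s| + K₁ * c with hK₂
  have hc : 0 < c := by exact_mod_cast h.b_pos
  have hK₂0 : 0 ≤ K₂ := by positivity
  have hlt : ∀ t ∈ forwardInterval (c : EReal), t ≤ c := fun t ht => by
    have := ht.2; exact_mod_cast this.le
  have step1 : ∀ t ∈ forwardInterval (c : EReal), s ≤ t → y.U t + 2 * R * y.N t ≤ K₂ := by
    intro t ht hst
    have hI := Icc_subset_forwardInterval hs.1 ht
    have := le_add_mul_of_hasDeriv (f := fun x => y.U x + 2 * R * y.N x) (c := K₁) hst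
      (fun x hx => ((h.deriv_U x (hI hx)).add ((h.deriv_N x (hI hx)).const_mul (2 * R))).mono hI)
      (fun x hx => ?_)
    · refine this.trans (add_le_add (le_abs_self _) (mul_le_mul_of_nonneg_left ?_ hK₁0))
      linarith [hs.1, hlt t ht]
    · have h1 := h.N'_le hE (hI hx)
      have h2 := h.N_le_κ (hI hx)
      obtain ⟨h3, h4⟩ := hfw x (hI hx) hx.1
      have h5 := h.r_pos x (hI hx)
      have h6 := hR x (hI hx)
      set v := (y.w x ^ 2 - 1) / y.r x with hv
      have hv0 : 0 ≤ v := div_nonneg (by nlinarith) h5.le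
      have e1 : y.V x = v ^ 2 := by simp only [Variables.V, hv, div_pow]; ring
      have e2 : y.w x * (1 - y.w x ^ 2) / y.r x = -(y.w x * v) := by simp only [hv]; ring
      rw [e1] at h1
      rw [e2]
      -- For `w ≤ 2` this is a quadratic in `v`; for `w ≥ 2`, `w ≤ w² - 1` and `r ≤ R` give `w ≤ R
      -- v`.
      have h7 : y.w x * v - R * v ^ 2 ≤ 4 := by
        rcases le_total (y.w x) 2 with h2w | h2w
        · nlinarith [sq_nonneg (v - 1), mul_nonneg (sub_nonneg.2 hR1) (sq_nonneg v),
            mul_nonneg (sub_nonneg.2 h2w) hv0]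
        · have : y.w x ≤ R * v := by
            have : y.w x * y.r x ≤ R * (y.w x ^ 2 - 1) :=
              (mul_le_mul_of_nonneg_left h6 (by linarith)).trans
                (by rw [mul_comm]; exact mul_le_mul_of_nonneg_left (by nlinarith) (by linarith))
            rw [hv, ← mul_div_assoc, le_div_iff₀ h5]
            exact this
          nlinarith
      have h8 := mul_le_mul_of_nonneg_left h1 (show 0 ≤ 2 * R by linarith)
      have h9 : 0 ≤ (y.κ x - y.N x) * y.U x := mul_nonneg (by linarith) h4.le
      rw [hK₁]
      linarith
  have step2 : ∀ t ∈ forwardInterval (c : EReal), s ≤ t →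
      y.w t ≤ y.w s + 2 * R * y.r s + R * K₂ * c := by
    intro t ht hst
    have hI := Icc_subset_forwardInterval hs.1 ht
    have := le_add_mul_of_hasDeriv (f := fun x => y.w x + 2 * R * y.r x) (c := R * K₂) hst
      (fun x hx => ((h.deriv_w x (hI hx)).add ((h.deriv_r x (hI hx)).const_mul (2 * R))).mono hI)
      (fun x hx => ?_)
    · have h1 : 0 < 2 * R * y.r t := mul_pos (by linarith) (h.r_pos t ht)
      have h2 : R * K₂ * (t - s) ≤ R * K₂ * c :=
        mul_le_mul_of_nonneg_left (by linarith [hs.1, hlt t ht]) (by positivity)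
      linarith
    · have h1 := step1 x (hI hx) hx.1
      have h2 := hR x (hI hx)
      have h3 := h.r_pos x (hI hx)
      have h4 : y.r x * (y.U x + 2 * R * y.N x) ≤ y.r x * K₂ := mul_le_mul_of_nonneg_left h1 h3.le
      have h5 : y.r x * K₂ ≤ R * K₂ := mul_le_mul_of_nonneg_right h2 hK₂0
      linarith
  obtain ⟨B, hB⟩ := (isCompact_Icc (a := (0 : ℝ)) (b := s)).exists_bound_of_continuousOn
    (h.cont_w.mono (Icc_subset_forwardInterval le_rfl hs))
  refine ⟨max B (y.w s + 2 * R * y.r s + R * K₂ * c), fun t ht => ?_⟩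
  rcases le_total t s with hts | hts
  · exact ((le_abs_self _).trans (hB t ⟨ht.1, hts⟩)).trans (le_max_left _ _)
  · exact (step2 t ht hts).trans (le_max_right _ _)

lemma exists_abs_w_le (hw : |w₀| ≤ 1) :
    ∃ W, 1 ≤ W ∧ ∀ ρ ∈ forwardInterval (c : EReal), |y.w ρ| ≤ W := by
  obtain ⟨W₁, h₁⟩ := h.exists_w_le hE hw
  obtain ⟨W₂, h₂⟩ := h.reflect.exists_w_le (by simpa [initialEnergy] using hE) (by simpa using hw)
  refine ⟨max 1 (max W₁ W₂), le_max_left _ _, fun ρ hρ => abs_le.2 ⟨?_, ?_⟩⟩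
  · have := h₂ ρ hρ
    simp only [Variables.reflect] at this
    linarith [(le_max_right W₁ W₂).trans (le_max_right 1 _)]
  · exact (h₁ ρ hρ).trans ((le_max_left _ _).trans (le_max_right _ _))

/-- The part of the force proportional to the negative part `n` of `N` is absorbed by the damping
`-(κ - N)U`, since `n ≤ κ - N`, once `|U| ≥ 2W`. What remains grows `U²` at rate at most `A`. -/
lemma exists_sq_U_le (hw : |w₀| ≤ 1) :
    ∃ C, ∀ ρ ∈ forwardInterval (c : EReal), y.U ρ ^ 2 ≤ C := by
  obtain ⟨W, hW1, hW⟩ := h.exists_abs_w_le hE hw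
  have hζ := h.ζ_zero_nonneg
  set S := 1 + 2 * (2 + y.ζ 0) with hS
  set A := 2 * W * S + 4 * W with hA
  have hA0 : 0 ≤ A := by positivity
  set B₀ := U₀ ^ 2 + 4 * W ^ 2 + 1 with hB₀
  have hB₀0 : 0 < B₀ := by positivity
  refine ⟨B₀ * Real.exp ((A + 1) * c), fun ρ hρ => ?_⟩
  have hI := Icc_subset_forwardInterval le_rfl hρ
  have hρc : ρ ≤ c := by have := hρ.2; exact_mod_cast this.le
  have key := le_barrier (f := fun x => y.U x ^ 2)
    (B := fun x => B₀ * Real.exp ((A + 1) * x)) hρ.1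
    (fun x hx => ((h.deriv_U x (hI hx)).mono hI).pow 2)
    (fun x hx => (((hasDerivWithinAt_id x _).const_mul (A + 1)).exp).const_mul B₀) ?_ ?_
  · refine key.trans ?_
    gcongr
  · simp only [h.init_U, mul_zero, Real.exp_zero, mul_one]
    rw [hB₀]; nlinarith [sq_nonneg W]
  · intro x hx hxe
    have hx' := hI (Ico_subset_Icc_self hx)
    have h1 := h.abs_force_le hE hx' (hW x hx')
    have h2 := h.N_le_κ hx'
    have h3 := h.κ_nonneg hx'
    set n := max (-y.N x) 0
    have hn0 : 0 ≤ n := le_max_right _ _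
    have hn : n ≤ y.κ x - y.N x := max_le (by linarith) (by linarith)
    set q := y.w x * (1 - y.w x ^ 2) / y.r x
    have hexp : 1 ≤ Real.exp ((A + 1) * x) := Real.one_le_exp (by have := hx.1; positivity)
    have hUB : B₀ ≤ y.U x ^ 2 := by
      rw [hxe]; exact le_mul_of_one_le_right hB₀0.le hexp
    have h5 := sq_abs (y.U x)
    have hU2 : 2 * W ≤ |y.U x| := by
      refine abs_le_of_sq_le_sq' (a := 2 * W) ?_ (abs_nonneg _) |>.2
      rw [h5]; nlinarith [sq_nonneg U₀]
    have hU1 : |y.U x| ≤ y.U x ^ 2 := by nlinarith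
    have h6 : -(y.U x * q) ≤ |y.U x| * (W * (S + 2 * n + 2 * |y.U x|)) := by
      refine (neg_le_abs _).trans ?_
      rw [abs_mul]
      exact mul_le_mul_of_nonneg_left h1 (abs_nonneg _)
    have h7 : n * y.U x ^ 2 ≤ (y.κ x - y.N x) * y.U x ^ 2 :=
      mul_le_mul_of_nonneg_right hn (sq_nonneg _)
    have h8 : 2 * |y.U x| * W * n ≤ n * y.U x ^ 2 := by
      rw [← h5]
      have := mul_le_mul_of_nonneg_left hU2 (mul_nonneg hn0 (abs_nonneg (y.U x)))
      nlinarith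
    have h9 : |y.U x| * (W * S) ≤ y.U x ^ 2 * (W * S) :=
      mul_le_mul_of_nonneg_right hU1 (by positivity)
    have e : B₀ * (Real.exp ((A + 1) * id x) * ((A + 1) * 1)) = (A + 1) * y.U x ^ 2 := by
      rw [hxe]; simp only [id]; ring
    rw [e]
    simp only [Nat.cast_ofNat, Nat.add_one_sub_one, pow_one]
    have e2 : |y.U x| * |y.U x| = y.U x ^ 2 := by rw [← h5]; ring
    have h10 : |y.U x| * (W * (S + 2 * n + 2 * |y.U x|)) =
        |y.U x| * (W * S) + 2 * |y.U x| * W * n + 2 * W * y.U x ^ 2 := by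
      rw [← e2]; ring
    rw [h10] at h6
    have h11 : A * y.U x ^ 2 = 2 * (y.U x ^ 2 * (W * S)) + 4 * W * y.U x ^ 2 := by rw [hA]; ring
    nlinarith

end Finite

end IsSolutionOn

end HauntedEYM

/-! ### Finite lifetime implies the singular class. -/

namespace HauntedEYM

open Set

namespace IsSolutionOn

variable {r₀ w₀ U₀ : ℝ} {y : Variables}

/-- Once `N` is sufficiently negative it decreases. -/
lemma N_antitone_of_lt {b : EReal} (h : IsSolutionOn r₀ w₀ U₀ b y)
    (hE : 0 ≤ initialEnergy r₀ w₀ U₀) {s t : ℝ} (hs : s ∈ forwardInterval b)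
    (hsN : y.N s < -(y.ζ 0 + 1)) (ht : t ∈ forwardInterval b) (hst : s ≤ t) :
    y.N t < -(y.ζ 0 + 1) ∧ y.N t ≤ y.N s := by
  have hζ := h.ζ_zero_nonneg
  -- For `N < 0` one has `N' ≤ -N² + ζ(0)²`.
  have hder : ∀ x ∈ forwardInterval b, y.N x < -(y.ζ 0 + 1) →
      1 - (1 - y.w x ^ 2) ^ 2 / y.r x ^ 2 - y.κ x * y.N x ≤ 0 := by
    intro x hx hN
    rw [h.N'_eq hE hx]
    have h1 := h.ζ_sq_le hx
    have h2 := h.κ_nonneg hx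
    nlinarith [sq_nonneg (y.U x)]
  have hlt : ∀ t ∈ forwardInterval b, s ≤ t → y.N t < -(y.ζ 0 + 1) := by
    intro t ht hst
    have hI := Icc_subset_forwardInterval hs.1 ht
    have := pos_of_linear (f := fun x => -(y.ζ 0 + 1) - y.N x) (a := fun _ => 0) hst
      (fun x hx => ((h.deriv_N x (hI hx)).const_sub _).mono hI) continuousOn_const (by linarith)
      (fun x hx hpos => by
        have := hder x (hI hx) (by linarith [hpos x ⟨hx.1, le_rfl⟩])
        linarith)
    linarith
  have hI := Icc_subset_forwardInterval hs.1 ht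
  exact ⟨hlt t ht hst, le_of_hasDeriv_nonpos hst (fun x hx => (h.deriv_N x (hI hx)).mono hI)
    (fun x hx => hder x (hI hx) (hlt x (hI hx) hx.1))⟩

end IsSolutionOn

/-- A maximal solution that exists only for a finite time is singular. -/
lemma IsMaximalSolution.isSingular {r₀ w₀ U₀ c : ℝ} {y : Variables}
    (hmax : IsMaximalSolution r₀ w₀ U₀ (c : EReal) y)
    (hE : 0 ≤ initialEnergy r₀ w₀ U₀) (hw : |w₀| ≤ 1) : IsSingular (c : EReal) y := by
  have h := hmax.1
  have hc : 0 < c := by exact_mod_cast h.b_pos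
  have hmem : ∀ x, x ∈ forwardInterval (c : EReal) ↔ 0 ≤ x ∧ x < c := fun x => by
    rw [forwardInterval_coe]; rfl
  obtain ⟨W, hW1, hW⟩ := h.exists_abs_w_le hE hw
  obtain ⟨D, hD⟩ := h.exists_sq_U_le hE hw
  obtain ⟨R, hR1, hR⟩ := h.exists_r_le hE
  have hζ0 := h.ζ_zero_nonneg
  have hD0 : 0 ≤ D := (sq_nonneg _).trans (hD 0 ((hmem 0).2 ⟨le_rfl, hc⟩))
  have hU : ∀ x ∈ forwardInterval (c : EReal), |y.U x| ≤ 1 + D := fun x hx =>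
    abs_le_of_sq_le_sq (by nlinarith [hD x hx]) (by linarith)
  have hκ : ∀ x ∈ forwardInterval (c : EReal), |y.κ x| ≤ (1 + 2 * D) * c := by
    intro x hx
    have hI := Icc_subset_forwardInterval le_rfl hx
    rw [abs_of_nonneg (h.κ_nonneg hx)]
    have := le_add_mul_of_hasDeriv (c := 1 + 2 * D) hx.1
      (fun z hz => (h.deriv_κ z (hI hz)).mono hI)
      (fun z hz => by nlinarith [hD z (hI hz), sq_nonneg (y.κ z)])
    rw [h.init_κ] at this
    have h2 : (1 + 2 * D) * (x - 0) ≤ (1 + 2 * D) * c :=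
      mul_le_mul_of_nonneg_left (by linarith [((hmem x).1 hx).2]) (by linarith)
    linarith
  have hζ : ∀ x ∈ forwardInterval (c : EReal), |y.ζ x| ≤ y.ζ 0 := fun x hx => by
    rw [abs_of_nonneg (h.ζ_nonneg hx)]; exact h.ζ_le hx
  -- A lower bound on `N` would keep `r` away from `0`, so all variables would be controlled and the
  -- solution would extend, against maximality.
  have hunb : ∀ M : ℝ, ∃ x ∈ forwardInterval (c : EReal), y.N x < -M := by
    by_contra! hcon
    obtain ⟨M, hM⟩ := hcon
    obtain ⟨δ, hδ, hr⟩ := h.exists_le_r hM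
    have hN : ∀ x ∈ forwardInterval (c : EReal), |y.N x| ≤ |M| + (2 + y.ζ 0) := fun x hx =>
      abs_le.2 ⟨by linarith [hM x hx, le_abs_self M], by linarith [h.N_le hE hx, abs_nonneg M]⟩
    set C := R + (|M| + (2 + y.ζ 0)) + W + (1 + D) + (1 + 2 * D) * c + y.ζ 0 with hC
    have hM0 := abs_nonneg M
    have hDc : 0 ≤ (1 + 2 * D) * c := by positivity
    obtain ⟨b', y', hb', hy', hag⟩ := h.exists_extension (C := C) hδ hr fun x hx => by
      have h1 := hN x hx
      have h2 := hW x hx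
      have h3 := hU x hx
      have h4 := hκ x hx
      have h5 := hζ x hx
      have h6 : |y.r x| ≤ R := by rw [abs_of_pos (h.r_pos x hx)]; exact hR x hx
      refine ⟨?_, ?_, ?_, ?_, ?_, ?_⟩ <;> linarith
    exact hmax.2 b' y' hb' hy' hag
  have hlow : ∀ M : ℝ, ∃ s ∈ forwardInterval (c : EReal), ∀ t ∈ forwardInterval (c : EReal),
      s ≤ t → y.N t ≤ -M ∧ y.N t < -(y.ζ 0 + 1) := by
    intro M
    obtain ⟨s, hs, hsN⟩ := hunb (max M (y.ζ 0 + 1))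
    refine ⟨s, hs, fun t ht hst => ?_⟩
    obtain ⟨h1, h2⟩ := h.N_antitone_of_lt hE hs
      (by linarith [le_max_right M (y.ζ 0 + 1)]) ht hst
    exact ⟨by linarith [le_max_left M (y.ζ 0 + 1)], h1⟩
  have hev : ∀ s ∈ forwardInterval (c : EReal), ∀ᶠ t in 𝓝[<] c,
      t ∈ forwardInterval (c : EReal) ∧ s ≤ t := by
    intro s hs
    filter_upwards [Ioo_mem_nhdsLT ((hmem s).1 hs).2] with t ht
    exact ⟨(hmem t).2 ⟨hs.1.trans ht.1.le, ht.2⟩, ht.1.le⟩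
  refine ⟨c, hc, rfl, ?_, ?_, W + (1 + D) + (1 + 2 * D) * c + y.ζ 0, ?_⟩
  · obtain ⟨s, hs, hsN⟩ := hlow 0
    have hanti : ∀ t ∈ forwardInterval (c : EReal), s ≤ t → ∀ u ∈ forwardInterval (c : EReal),
        t ≤ u → y.r u ≤ y.r t := by
      intro t ht hst u hu htu
      have hI := Icc_subset_forwardInterval ht.1 hu
      refine le_of_hasDeriv_nonpos htu (fun x hx => (h.deriv_r x (hI hx)).mono hI) fun x hx => ?_
      have := (hsN x (hI hx) (hst.trans hx.1)).2
      exact mul_nonpos_of_nonneg_of_nonpos (h.r_pos x (hI hx)).le (by linarith)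
    -- If `r ≥ ε` persisted, then `V ≤ K` and `N' ≥ -K`, so `N` would stay bounded below in finite
    -- time.
    have hsmall : ∀ ε > 0, ∃ t ∈ forwardInterval (c : EReal), s ≤ t ∧ y.r t < ε := by
      intro ε hε
      by_contra! hcon
      set K := (1 + W ^ 2) ^ 2 / ε ^ 2 with hK
      have hNb : ∀ t ∈ forwardInterval (c : EReal), s ≤ t → y.N s - K * c ≤ y.N t := by
        intro t ht hst
        have hI := Icc_subset_forwardInterval hs.1 ht
        have := add_mul_le_of_hasDeriv (c := -K) hst
          (fun x hx => (h.deriv_N x (hI hx)).mono hI) fun x hx => ?_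
        · have h1 : K * (t - s) ≤ K * c :=
            mul_le_mul_of_nonneg_left (by linarith [hs.1, ((hmem t).1 ht).2]) (by positivity)
          linarith
        · have h1 := hcon x (hI hx) hx.1
          have h2 := (hsN x (hI hx) hx.1).2
          have h3 := h.κ_nonneg (hI hx)
          have h4 : y.w x ^ 2 ≤ W ^ 2 :=
            sq_le_sq' (abs_le.1 (hW x (hI hx))).1 (abs_le.1 (hW x (hI hx))).2
          have h5 : (1 - y.w x ^ 2) ^ 2 ≤ (1 + W ^ 2) ^ 2 := by
            apply sq_le_sq' <;> nlinarith [sq_nonneg (y.w x)]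
          have h6 : (1 - y.w x ^ 2) ^ 2 / y.r x ^ 2 ≤ K := by
            rw [hK]; gcongr
          nlinarith
      obtain ⟨u, hu, huN⟩ := hlow (K * c - y.N s + 1)
      have h1 := hu.1
      have hm : max u s ∈ forwardInterval (c : EReal) :=
        (hmem _).2 ⟨hu.1.trans (le_max_left _ _), max_lt ((hmem u).1 hu).2 ((hmem s).1 hs).2⟩
      linarith [(huN _ hm (le_max_left _ _)).1, hNb _ hm (le_max_right _ _)]
    rw [Metric.tendsto_nhds]
    intro ε hε
    obtain ⟨t, ht, hst, htε⟩ := hsmall ε hε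
    filter_upwards [hev t ht] with u hu
    rw [Real.dist_eq, sub_zero, abs_of_pos (h.r_pos u hu.1)]
    exact (hanti t ht hst u hu.1 hu.2).trans_lt htε
  · rw [tendsto_atBot]
    intro M
    obtain ⟨s, hs, hsN⟩ := hlow (-M)
    filter_upwards [hev s hs] with t ht
    linarith [(hsN t ht.1 ht.2).1]
  · filter_upwards [hev 0 ((hmem 0).2 ⟨le_rfl, hc⟩)] with t ht
    have h2 := hW t ht.1
    have h3 := hU t ht.1
    have h4 := hκ t ht.1
    have h5 := hζ t ht.1
    have hDc : 0 ≤ (1 + 2 * D) * c := by positivity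
    refine ⟨?_, ?_, ?_, ?_⟩ <;> linarith

end HauntedEYM

/-! ### Global solutions: uniform bounds and the dichotomy for `r`. -/

namespace HauntedEYM

open Set

lemma mem_forwardInterval_top {x : ℝ} : x ∈ forwardInterval ⊤ ↔ 0 ≤ x := by
  simp [forwardInterval]

lemma hasDerivAt_of_forward {f : ℝ → ℝ} {d x : ℝ} (hx : 0 < x)
    (hf : HasDerivWithinAt f d (forwardInterval ⊤) x) : HasDerivAt f d x :=
  hf.hasDerivAt (forwardInterval_mem_nhds (mem_forwardInterval_top.2 hx.le) hx)

namespace IsSolutionOn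

section Global

variable {r₀ w₀ U₀ : ℝ} {y : Variables} (h : IsSolutionOn r₀ w₀ U₀ ⊤ y)
include h

lemma r_pos' {x : ℝ} (hx : 0 ≤ x) : 0 < y.r x := h.r_pos x (mem_forwardInterval_top.2 hx)

lemma dr {x : ℝ} (hx : 0 < x) : HasDerivAt y.r (y.r x * y.N x) x :=
  hasDerivAt_of_forward hx (h.deriv_r x (mem_forwardInterval_top.2 hx.le))

lemma dN {x : ℝ} (hx : 0 < x) : HasDerivAt y.N (1 - y.V x - y.κ x * y.N x) x :=
  hasDerivAt_of_forward hx (h.deriv_N x (mem_forwardInterval_top.2 hx.le))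

lemma dw {x : ℝ} (hx : 0 < x) : HasDerivAt y.w (y.r x * y.U x) x :=
  hasDerivAt_of_forward hx (h.deriv_w x (mem_forwardInterval_top.2 hx.le))

lemma dU {x : ℝ} (hx : 0 < x) : HasDerivAt y.U
    (-(y.κ x - y.N x) * y.U x - y.w x * (1 - y.w x ^ 2) / y.r x) x :=
  hasDerivAt_of_forward hx (h.deriv_U x (mem_forwardInterval_top.2 hx.le))

lemma dκ {x : ℝ} (hx : 0 < x) : HasDerivAt y.κ (1 + 2 * y.U x ^ 2 - y.κ x ^ 2) x :=
  hasDerivAt_of_forward hx (h.deriv_κ x (mem_forwardInterval_top.2 hx.le))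

lemma dζ {x : ℝ} (hx : 0 < x) : HasDerivAt y.ζ (-y.κ x * y.ζ x) x :=
  hasDerivAt_of_forward hx (h.deriv_ζ x (mem_forwardInterval_top.2 hx.le))

lemma dζsq {x : ℝ} (hx : 0 < x) : HasDerivAt (fun x => y.ζ x ^ 2) (-2 * y.κ x * y.ζ x ^ 2) x :=
  ((h.dζ hx).pow 2).congr_deriv (by simp; ring)

lemma drU {x : ℝ} (hx : 0 < x) : HasDerivAt (fun ρ => y.r ρ * y.U ρ)
    ((2 * y.N x - y.κ x) * (y.r x * y.U x) - y.w x * (1 - y.w x ^ 2)) x :=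
  hasDerivAt_of_forward hx (h.deriv_rU (mem_forwardInterval_top.2 hx.le))

lemma denergy {x : ℝ} (hx : 0 < x) : HasDerivAt y.energy
    (4 * (2 * y.N x - y.κ x) * (y.r x * y.U x) ^ 2) x :=
  hasDerivAt_of_forward hx (h.deriv_energy (mem_forwardInterval_top.2 hx.le))

lemma dlogr {x : ℝ} (hx : 0 < x) : HasDerivAt (fun x => Real.log (y.r x)) (y.N x) x :=
  ((h.dr hx).log (h.r_pos' hx.le).ne').congr_deriv (by
    have := (h.r_pos' hx.le).ne'; field_simp)

lemma κ_nonneg' {x : ℝ} (hx : 0 ≤ x) : 0 ≤ y.κ x := h.κ_nonneg (mem_forwardInterval_top.2 hx)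

lemma half_le_κ' {x : ℝ} (hx : 1 ≤ x) : 1 / 2 ≤ y.κ x :=
  h.half_le_κ (mem_forwardInterval_top.2 (by linarith)) hx

lemma N_le_κ' {x : ℝ} (hx : 0 ≤ x) : y.N x ≤ y.κ x := h.N_le_κ (mem_forwardInterval_top.2 hx)

lemma tendsto_ζ : Tendsto y.ζ atTop (𝓝 0) := by
  have h1 : Tendsto (fun x => y.ζ x ^ 2) atTop (𝓝 0) := by
    refine tendsto_zero_of_deriv_le (T := 1) (δ := fun _ => 0) (fun x hx => h.dζsq (by linarith))
      (fun x _ => sq_nonneg _) (fun x hx => ?_) tendsto_const_nhds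
    nlinarith [h.half_le_κ' hx, sq_nonneg (y.ζ x)]
  have := h1.sqrt
  simp only [Real.sqrt_sq_eq_abs, Real.sqrt_zero] at this
  exact (tendsto_zero_iff_abs_tendsto_zero _).2 this

variable (hE : 0 ≤ initialEnergy r₀ w₀ U₀)
include hE

lemma constraint' {x : ℝ} (hx : 0 ≤ x) :
    y.ζ x ^ 2 = 1 + 2 * y.U x ^ 2 - y.V x + y.N x ^ 2 - 2 * y.κ x * y.N x :=
  h.constraint hE (mem_forwardInterval_top.2 hx)

/-- Below this threshold the Riccati inequality `N' ≤ -N² + ζ(0)²` blows up in finite time; here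
`arctan N` would decrease at a fixed positive rate forever. -/
lemma N_ge {s : ℝ} (hs : 0 ≤ s) : -(y.ζ 0 + 1) ≤ y.N s := by
  by_contra! hlt
  have hζ := h.ζ_zero_nonneg
  set m := y.ζ 0 + 1 with hm
  have hm0 : 1 ≤ m := by linarith
  have hN : ∀ x, s ≤ x → y.N x < -m := fun x hx =>
    (h.N_antitone_of_lt hE (mem_forwardInterval_top.2 hs) hlt
      (mem_forwardInterval_top.2 (hs.trans hx)) hx).1
  have hbot : Tendsto (fun x => Real.arctan (y.N x)) atTop atBot := by
    refine tendsto_atBot_of_hasDeriv (T := s + 1) (c := 1 / (2 * m ^ 2)) (by positivity)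
      (fun x hx => (h.dN (by linarith)).arctan) ?_
    filter_upwards [eventually_ge_atTop (s + 1)] with x hx
    have hx0 : 0 ≤ x := by linarith
    have h1 := h.constraint' hE hx0
    have h2 := h.ζ_sq_le (mem_forwardInterval_top.2 hx0)
    have h3 := h.κ_nonneg' hx0
    have h4 := hN x (by linarith)
    have h5 : 1 - y.V x - y.κ x * y.N x ≤ -y.N x ^ 2 + (m - 1) ^ 2 := by
      have : (m - 1) ^ 2 = y.ζ 0 ^ 2 := by rw [hm]; ring
      nlinarith [sq_nonneg (y.U x)]
    have h6 : m ^ 2 ≤ y.N x ^ 2 := by nlinarith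
    have h7 : 2 * m ^ 2 * (y.N x ^ 2 - (m - 1) ^ 2) ≥ 1 + y.N x ^ 2 := by
      nlinarith [mul_nonneg (show 0 ≤ m - 1 by linarith) (show 0 ≤ m by linarith),
        mul_le_mul_of_nonneg_left h6 (show 0 ≤ 2 * m ^ 2 - 1 by nlinarith)]
    rw [div_mul_eq_mul_div, one_mul, ← neg_div, div_le_div_iff₀ (by positivity) (by positivity)]
    nlinarith
  obtain ⟨x, hx⟩ := (hbot.eventually_lt_atBot (-(Real.pi / 2))).exists
  linarith [Real.neg_pi_div_two_lt_arctan (y.N x)]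

lemma κ_le {s : ℝ} (hs : 0 ≤ s) : y.κ s ≤ 5 + 3 * y.ζ 0 := by
  linarith [h.N_ge hE hs, h.κ_add_N_le hE (mem_forwardInterval_top.2 hs)]

lemma abs_N_le {s : ℝ} (hs : 0 ≤ s) : |y.N s| ≤ 5 + 3 * y.ζ 0 := by
  have := h.ζ_zero_nonneg
  exact abs_le.2 ⟨by linarith [h.N_ge hE hs], (h.N_le_κ' hs).trans (h.κ_le hE hs)⟩

/-- The quantity `P = -(N + ζ²)` satisfies `P' = κP + (3κ - 1)ζ² + N² + 2U² ≥ κP`, as `κ ≥ 1/2`. If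
ever positive, it would grow without bound, against `N_ge`. -/
lemma N_ge_neg_ζsq {s : ℝ} (hs : 1 ≤ s) : -y.ζ s ^ 2 ≤ y.N s := by
  by_contra! hlt
  have hder : ∀ x, s ≤ x → HasDerivAt (fun x => -(y.N x + y.ζ x ^ 2))
      (-(1 - y.V x - y.κ x * y.N x + -2 * y.κ x * y.ζ x ^ 2)) x := fun x hx =>
    ((h.dN (by linarith)).add (h.dζsq (by linarith))).neg
  have hlin : ∀ x, s ≤ x → 0 < -(y.N x + y.ζ x ^ 2) → y.κ x * -(y.N x + y.ζ x ^ 2) ≤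
      -(1 - y.V x - y.κ x * y.N x + -2 * y.κ x * y.ζ x ^ 2) := by
    intro x hx _
    have h1 := h.constraint' hE (show 0 ≤ x by linarith)
    have h2 := h.half_le_κ' (hs.trans hx)
    nlinarith [sq_nonneg (y.U x), sq_nonneg (y.N x), sq_nonneg (y.ζ x)]
  have hpos : ∀ x, s ≤ x → 0 < -(y.N x + y.ζ x ^ 2) := by
    intro x hx
    refine pos_of_linear (f := fun x => -(y.N x + y.ζ x ^ 2)) (a := y.κ) hx
      (hasDerivWithinAt_Icc_of_le hder le_rfl)
      (h.cont_κ.mono (Icc_subset_forwardInterval (by linarith)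
        (mem_forwardInterval_top.2 (by linarith)))) (by linarith)
      fun z hz hzp => hlin z hz.1 (hzp z ⟨hz.1, le_rfl⟩)
  have hmono : ∀ x, s ≤ x → -(y.N s + y.ζ s ^ 2) ≤ -(y.N x + y.ζ x ^ 2) := fun x hx =>
    le_of_hasDeriv_nonneg (f := fun x => -(y.N x + y.ζ x ^ 2)) hx
      (hasDerivWithinAt_Icc_of_le hder le_rfl) fun z hz =>
        (mul_nonneg (h.κ_nonneg' (by linarith [hz.1])) (hpos z hz.1).le).trans
          (hlin z hz.1 (hpos z hz.1))
  have htop := tendsto_atTop_of_hasDeriv (c := -(y.N s + y.ζ s ^ 2) / 2)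
    (by linarith) hder (by
      filter_upwards [eventually_ge_atTop s] with x hx
      have h1 := h.half_le_κ' (hs.trans hx)
      have h2 := hmono x hx
      have h3 := hlin x hx (hpos x hx)
      have h4 := mul_le_mul_of_nonneg_right h1 (hpos x hx).le
      linarith)
  obtain ⟨x, hx, hx0⟩ :=
    ((htop.eventually_gt_atTop (y.ζ 0 + 1)).and (eventually_ge_atTop 0)).exists
  nlinarith [h.N_ge hE hx0, sq_nonneg (y.ζ x)]

/-- Either `r` converges to a positive limit or it grows without bound. -/
lemma r_dichotomy : (∃ l, Tendsto (fun x => Real.log (y.r x) - y.ζ x ^ 2) atTop (𝓝 l)) ∨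
    Tendsto y.r atTop atTop := by
  -- `F' = N + 2κζ² ≥ N + ζ² ≥ 0` for `ρ ≥ 1`.
  set F := fun x => Real.log (y.r x) - y.ζ x ^ 2 with hF
  have hder : ∀ x, 1 ≤ x → HasDerivAt F (y.N x - -2 * y.κ x * y.ζ x ^ 2) x := fun x hx =>
    (h.dlogr (by linarith)).sub (h.dζsq (by linarith))
  have hnn : ∀ x, 1 ≤ x → 0 ≤ y.N x - -2 * y.κ x * y.ζ x ^ 2 := fun x hx => by
    nlinarith [h.N_ge_neg_ζsq hE hx, h.half_le_κ' hx, sq_nonneg (y.ζ x)]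
  by_cases hb : ∃ C, ∀ x, 1 ≤ x → F x ≤ C
  · obtain ⟨C, hC⟩ := hb
    exact Or.inl (exists_tendsto_of_deriv_nonneg hder hnn hC)
  · right
    push Not at hb
    rw [tendsto_atTop]
    intro M
    obtain ⟨s, hs, hsM⟩ := hb (max M 1)
    filter_upwards [eventually_ge_atTop s] with x hx
    have h1 : F s ≤ F x := le_of_hasDeriv_nonneg hx (hasDerivWithinAt_Icc_of_le hder hs)
      (fun z hz => hnn z (hs.trans hz.1))
    have hr := h.r_pos' (show 0 ≤ x by linarith)
    have h2 : Real.log (y.r x) ≤ y.r x - 1 := Real.log_le_sub_one_of_pos hr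
    have h3 : F x ≤ Real.log (y.r x) := by simp only [hF]; nlinarith [sq_nonneg (y.ζ x)]
    linarith [le_max_left M 1]

lemma w_le_one (hw : |w₀| ≤ 1) {s : ℝ} (hs : 0 ≤ s) : y.w s ≤ 1 := by
  by_contra! hgt
  obtain ⟨T, -, hT0, hwT, hT⟩ := h.exists_w_gt hw (mem_forwardInterval_top.2 hs) hgt
  have hT' : ∀ x, T ≤ x → y.w T ≤ y.w x ∧ 0 < y.U x := fun x hx =>
    hT x (mem_forwardInterval_top.2 (by linarith)) hx
  have hmono : ∀ u v, T ≤ u → u ≤ v → y.w u ≤ y.w v := fun u v hu huv =>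
    le_of_hasDeriv_nonneg huv
      (hasDerivWithinAt_Icc_of_le (fun x hx => h.dw (by linarith)) hu)
      (fun z hz => (mul_pos (h.r_pos' (by linarith [hz.1])) (hT' z (hu.trans hz.1)).2).le)
  set K := 5 + 3 * y.ζ 0 with hK
  have hK0 : 0 < K := by have := h.ζ_zero_nonneg; positivity
  have hNK : ∀ x, T ≤ x → |y.N x| ≤ K := fun x hx => h.abs_N_le hE (by linarith)
  have hκK : ∀ x, T ≤ x → y.κ x ≤ K := fun x hx => h.κ_le hE (by linarith)
  have hκ0 : ∀ x, T ≤ x → 0 ≤ y.κ x := fun x hx => h.κ_nonneg' (by linarith)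
  have hr0 : ∀ x, T ≤ x → 0 < y.r x := fun x hx => h.r_pos' (by linarith)
  -- `w` is unbounded
  have hg : Tendsto (fun x => y.r x * y.U x + 3 * K * y.w x) atTop atTop := by
    refine tendsto_atTop_of_hasDeriv (T := T) (c := y.w T ^ 2 - 1) (by nlinarith)
      (fun x hx => (h.drU (by linarith)).add ((h.dw (by linarith)).const_mul (3 * K))) ?_
    filter_upwards [eventually_ge_atTop T] with x hx
    obtain ⟨h1, h2⟩ := hT' x hx
    have h3 := mul_pos (hr0 x hx) h2
    have h4 := (abs_le.1 (hNK x hx)).1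
    have h5 : 0 ≤ (2 * y.N x - y.κ x + 3 * K) * (y.r x * y.U x) :=
      mul_nonneg (by linarith [hκK x hx]) h3.le
    have h6 : y.w T ^ 2 - 1 ≤ y.w x * (y.w x ^ 2 - 1) := by
      have h7 : y.w T ^ 2 ≤ y.w x ^ 2 := pow_le_pow_left₀ (by linarith) h1 2
      have h8 : 1 ≤ y.w T ^ 2 := by nlinarith
      nlinarith [mul_nonneg (show 0 ≤ y.w x - 1 by linarith) (show 0 ≤ y.w x ^ 2 - 1 by linarith)]
    linarith
  -- While `w` is bounded, divergence of `rU + 3Kw` makes `w' = rU` large. The level `2K + 1` lets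
  -- `w` dominate `|N|` and `κ - N` below.
  have hwub : ∃ s, T ≤ s ∧ 2 * K + 1 ≤ y.w s := by
    by_contra! hcon
    have htop : Tendsto y.w atTop atTop := by
      refine tendsto_atTop_of_hasDeriv (T := T) one_pos (fun x hx => h.dw (by linarith)) ?_
      filter_upwards [eventually_ge_atTop T,
        hg.eventually_ge_atTop (1 + 3 * K * (2 * K + 1))] with x hx hx1
      nlinarith [hcon x hx]
    obtain ⟨x, hx, hx1⟩ :=
      ((htop.eventually_ge_atTop (2 * K + 1)).and (eventually_ge_atTop T)).exists
    linarith [hcon x hx1]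
  obtain ⟨s, hTs, hws⟩ := hwub
  have hwx : ∀ x, s ≤ x → 2 * K + 1 ≤ y.w x := fun x hx => hws.trans (hmono s x hTs hx)
  -- `v` is the positive root of `V`. For `w ≥ 2K + 1` the pair `(U, v)` satisfies `(U + v)' ≥ U +
  -- v`, so the sum diverges.
  set v := fun x => (y.w x ^ 2 - 1) / y.r x with hv
  have hv0 : ∀ x, s ≤ x → 0 ≤ v x := fun x hx =>
    div_nonneg (by nlinarith [hwx x hx]) (hr0 x (hTs.trans hx)).le
  have hvV : ∀ x, y.V x = v x ^ 2 := fun x => by simp only [Variables.V, hv, div_pow]; ring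
  have hdv : ∀ x, s ≤ x → HasDerivAt v (2 * y.w x * y.U x - v x * y.N x) x := by
    intro x hx
    have hr := (hr0 x (hTs.trans hx)).ne'
    refine ((((h.dw (by linarith)).pow 2).sub_const 1).div (h.dr (by linarith)) hr).congr_deriv ?_
    simp only [hv, Nat.cast_ofNat, Nat.add_one_sub_one, pow_one, Pi.pow_apply]
    field_simp
  have hdU : ∀ x, s ≤ x → HasDerivAt y.U (-(y.κ x - y.N x) * y.U x + y.w x * v x) x := by
    intro x hx
    exact (h.dU (by linarith)).congr_deriv (by simp only [hv]; ring)
  have hUv : ∀ x, s ≤ x → y.U x + v x ≤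
      (-(y.κ x - y.N x) * y.U x + y.w x * v x) + (2 * y.w x * y.U x - v x * y.N x) := by
    intro x hx
    have h1 := hwx x hx
    have h2 := abs_le.1 (hNK x (hTs.trans hx))
    have h3 := hκK x (hTs.trans hx)
    have h4 := mul_nonneg (show 0 ≤ -(y.κ x - y.N x) + 2 * y.w x - 1 by linarith)
      (hT' x (hTs.trans hx)).2.le
    have h5 := mul_nonneg (show 0 ≤ y.w x - y.N x - 1 by linarith) (hv0 x hx)
    linarith
  have hds : ∀ x, s ≤ x → HasDerivAt (fun x => y.U x + v x)
      ((-(y.κ x - y.N x) * y.U x + y.w x * v x) + (2 * y.w x * y.U x - v x * y.N x)) x :=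
    fun x hx => (hdU x hx).add (hdv x hx)
  have hs0 : ∀ x, s ≤ x → 0 < y.U x + v x := fun x hx => by
    linarith [(hT' x (hTs.trans hx)).2, hv0 x hx]
  have hsum : Tendsto (fun x => y.U x + v x) atTop atTop := by
    refine tendsto_atTop_of_hasDeriv (hs0 s le_rfl) hds ?_
    filter_upwards [eventually_ge_atTop s] with x hx
    exact (le_of_hasDeriv_nonneg hx (hasDerivWithinAt_Icc_of_le hds le_rfl)
      (fun z hz => (hs0 z hz.1).le.trans (hUv z hz.1))).trans (hUv x hx)
  -- Subtracting `(K + 2)N` adds `(K + 2)v²` to the derivative, which outweighs `-vN`; as `N` is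
  -- bounded, `v` itself diverges. Then `V = v²` forces `N → -∞`, a contradiction.
  have hvtop : Tendsto v atTop atTop := by
    have h1 : Tendsto (fun x => v x - (K + 2) * y.N x) atTop atTop := by
      refine tendsto_atTop_of_hasDeriv (T := s) one_pos (fun x hx => (hdv x hx).sub
        ((h.dN (by linarith)).const_mul (K + 2))) ?_
      filter_upwards [eventually_ge_atTop s,
        hsum.eventually_ge_atTop ((K + 2) * (2 + K ^ 2))] with x hx hxs
      have h2 := hwx x hx
      have h3 := abs_le.1 (hNK x (hTs.trans hx))
      have h4 := (hT' x (hTs.trans hx)).2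
      have h5 := hv0 x hx
      have h6 : -(y.κ x * y.N x) ≤ K ^ 2 := by
        nlinarith [hκK x (hTs.trans hx), hκ0 x (hTs.trans hx)]
      rw [hvV]
      have h7 : 2 * y.U x ≤ 2 * y.w x * y.U x := by nlinarith
      have h8 : v x * y.N x ≤ v x * K := mul_le_mul_of_nonneg_left h3.2 h5
      have h9 := mul_le_mul_of_nonneg_left h6 (show 0 ≤ K + 2 by linarith)
      nlinarith [mul_nonneg (show 0 ≤ K + 2 by linarith) (sq_nonneg (v x - 1 / 2))]
    refine tendsto_atTop_mono' atTop ?_ (tendsto_atTop_add_const_right atTop (-((K + 2) * K)) h1)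
    filter_upwards [eventually_ge_atTop T] with x hx
    have := (abs_le.1 (hNK x hx)).1
    nlinarith
  have hNbot : Tendsto y.N atTop atBot := by
    refine tendsto_atBot_of_hasDeriv (T := s) one_pos (fun x hx => h.dN (by linarith)) ?_
    filter_upwards [eventually_ge_atTop s, hvtop.eventually_ge_atTop (2 + K ^ 2)] with x hx hxv
    have h3 := abs_le.1 (hNK x (hTs.trans hx))
    have h6 : -(y.κ x * y.N x) ≤ K ^ 2 := by
      nlinarith [hκK x (hTs.trans hx), hκ0 x (hTs.trans hx)]
    rw [hvV]
    nlinarith [sq_nonneg K]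
  obtain ⟨x, hx, hx1⟩ := ((hNbot.eventually_lt_atBot (-K)).and (eventually_ge_atTop T)).exists
  linarith [(abs_le.1 (hNK x hx1)).1]

lemma abs_w_le_one (hw : |w₀| ≤ 1) {s : ℝ} (hs : 0 ≤ s) : |y.w s| ≤ 1 := by
  have h1 := h.w_le_one hE hw hs
  have h2 := h.reflect.w_le_one (by simpa [initialEnergy] using hE) (by simpa using hw) hs
  simp only [Variables.reflect] at h2
  exact abs_le.2 ⟨by linarith, h1⟩

end Global

end IsSolutionOn

end HauntedEYM

/-! ### Convergent `r`: the cylindrical class. -/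

namespace HauntedEYM

open Set

lemma hasDerivAt_min_zero_sq (t : ℝ) : HasDerivAt (fun t : ℝ => min t 0 ^ 2) (2 * min t 0) t := by
  rcases lt_trichotomy t 0 with ht | rfl | ht
  · rw [min_eq_left ht.le]
    refine (((hasDerivAt_id t).pow 2).congr_deriv (by simp)).congr_of_eventuallyEq ?_
    filter_upwards [Iio_mem_nhds ht] with x hx
    rw [min_eq_left (mem_Iio.1 hx).le]; rfl
  · rw [hasDerivAt_iff_isLittleO]
    simp only [min_self, mul_zero, smul_zero, sub_zero, ne_eq, OfNat.ofNat_ne_zero,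
      not_false_eq_true, zero_pow]
    have h1 : (fun x : ℝ => min x 0 ^ 2) =O[𝓝 0] fun x : ℝ => x ^ 2 := by
      refine Asymptotics.IsBigO.of_bound 1 (Eventually.of_forall fun x => ?_)
      rw [one_mul, norm_pow, norm_pow]
      refine pow_le_pow_left₀ (norm_nonneg _) ?_ 2
      rcases le_total x 0 with hx | hx
      · rw [min_eq_left hx]
      · rw [min_eq_right hx]; simp
    refine h1.trans_isLittleO ?_
    simpa using Asymptotics.isLittleO_pow_pow (𝕜 := ℝ) (m := 1) (n := 2) (by norm_num)
  · rw [min_eq_right ht.le, mul_zero]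
    refine (hasDerivAt_const t (0 : ℝ)).congr_of_eventuallyEq ?_
    filter_upwards [Ioi_mem_nhds ht] with x hx
    rw [min_eq_right (mem_Ioi.1 hx).le]; simp

lemma tendsto_zero_mul_of_bounded {f g : ℝ → ℝ} {K T : ℝ} (hf : ∀ x, T ≤ x → |f x| ≤ K)
    (hg : Tendsto g atTop (𝓝 0)) : Tendsto (fun x => f x * g x) atTop (𝓝 0) := by
  refine squeeze_zero_norm' (a := fun x => K * |g x|) ?_ (by simpa using hg.abs.const_mul K)
  filter_upwards [eventually_ge_atTop T] with x hx
  rw [Real.norm_eq_abs, abs_mul]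
  exact mul_le_mul_of_nonneg_right (hf x hx) (abs_nonneg _)

lemma Variables.V_le {y : Variables} {ρ δ : ℝ} (hδ : 0 < δ) (hr : δ ≤ y.r ρ) (hw : |y.w ρ| ≤ 1) :
    y.V ρ ≤ 1 / δ ^ 2 := by
  have h1 : (1 - y.w ρ ^ 2) ^ 2 ≤ 1 := by
    have := (sq_le_one_iff_abs_le_one _).2 hw
    nlinarith [sq_nonneg (y.w ρ)]
  unfold Variables.V
  gcongr

namespace IsSolutionOn

section Global

variable {r₀ w₀ U₀ : ℝ} {y : Variables} (h : IsSolutionOn r₀ w₀ U₀ ⊤ y)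
  (hE : 0 ≤ initialEnergy r₀ w₀ U₀) (hw : |w₀| ≤ 1)
include h hE hw

lemma w_sq_le_one {s : ℝ} (hs : 0 ≤ s) : y.w s ^ 2 ≤ 1 :=
  (sq_le_one_iff_abs_le_one _).2 (h.abs_w_le_one hE hw hs)

omit hw in
lemma abs_coeff_le {s : ℝ} (hs : 0 ≤ s) : |2 * y.N s - y.κ s| ≤ 3 * (5 + 3 * y.ζ 0) := by
  have h1 := abs_le.1 (h.abs_N_le hE hs)
  have h2 := h.κ_le hE hs
  have h3 := h.κ_nonneg' hs
  exact abs_le.2 ⟨by linarith, by linarith⟩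

/-- If `ẇ²` is bounded and dominated by the derivative of a convergent function, then `ẇ → 0`. -/
lemma tendsto_rU {F F' : ℝ → ℝ} {T B l : ℝ} (hT : 1 ≤ T)
    (hB : ∀ x, T ≤ x → (y.r x * y.U x) ^ 2 ≤ B) (hF : ∀ x, T ≤ x → HasDerivAt F (F' x) x)
    (hF' : ∀ x, T ≤ x → (y.r x * y.U x) ^ 2 ≤ F' x) (hl : Tendsto F atTop (𝓝 l)) :
    Tendsto (fun x => y.r x * y.U x) atTop (𝓝 0) := by
  have h1 : Tendsto (fun x => (y.r x * y.U x) ^ 2) atTop (𝓝 0) := by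
    refine tendsto_zero_of_barbalat (C := 6 * (5 + 3 * y.ζ 0) * B + 2 * (1 + B)) hF
      (fun x hx => (h.drU (by linarith)).pow 2) (fun x _ => sq_nonneg _) hF' (fun x hx => ?_) hl
    have hx0 : 0 ≤ x := by linarith
    have h2 := (abs_le.1 (h.abs_coeff_le hE hx0)).1
    have h3 := hB x hx
    have h4 := h.w_sq_le_one hE hw hx0
    have h5 := h.ζ_zero_nonneg
    set z := y.r x * y.U x
    have h6 : (y.w x * (1 - y.w x ^ 2)) ^ 2 ≤ 1 := by
      rw [mul_pow]
      have : (1 - y.w x ^ 2) ^ 2 ≤ 1 := by nlinarith [sq_nonneg (y.w x)]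
      nlinarith [sq_nonneg (y.w x), sq_nonneg (1 - y.w x ^ 2)]
    have h7 : (2 * y.N x - y.κ x) * z ^ 2 ≥ -(3 * (5 + 3 * y.ζ 0)) * B := by
      nlinarith [sq_nonneg z]
    have h8 : z * (y.w x * (1 - y.w x ^ 2)) ≤ 1 + B := by
      nlinarith [sq_nonneg (z - y.w x * (1 - y.w x ^ 2)), sq_nonneg z]
    simp only [Nat.cast_ofNat, Nat.add_one_sub_one, pow_one]
    nlinarith
  have := h1.sqrt
  simp only [Real.sqrt_sq_eq_abs, Real.sqrt_zero] at this
  exact (tendsto_zero_iff_abs_tendsto_zero _).2 this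

/-- If `ẇ → 0` and the Yang-Mills energy converges, then `w` tends to a critical point of the
potential. -/
lemma w_limit {L : ℝ} (hz : Tendsto (fun x => y.r x * y.U x) atTop (𝓝 0))
    (hL : Tendsto y.energy atTop (𝓝 L)) :
    ∃ m : ℝ, (m = 0 ∨ m = 1 ∨ m = -1) ∧ Tendsto y.w atTop (𝓝 m) := by
  have h1 : Tendsto (fun x => 1 - √(2 * (y.r x * y.U x) ^ 2 - y.energy x)) atTop
      (𝓝 (1 - √(2 * 0 ^ 2 - L))) :=
    (((hz.pow 2).const_mul 2).sub hL).sqrt.const_sub 1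
  have h2 : Tendsto (fun x => y.w x ^ 2) atTop (𝓝 (1 - √(2 * 0 ^ 2 - L))) := by
    refine h1.congr' ?_
    filter_upwards [eventually_ge_atTop 0] with x hx
    have h3 := h.w_sq_le_one hE hw hx
    have e : 2 * (y.r x * y.U x) ^ 2 - y.energy x = (1 - y.w x ^ 2) ^ 2 := by
      simp only [Variables.energy]; ring
    rw [e, Real.sqrt_sq (by linarith)]
    ring
  obtain ⟨m, hm⟩ : ∃ m, Tendsto y.w atTop (𝓝 m) := by
    rcases tendsto_of_sq_tendsto (T := 1)
      (fun x hx => (h.dw (show 0 < x by linarith)).continuousAt) h2 with h3 | h3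
    exacts [⟨_, h3⟩, ⟨_, h3⟩]
  refine ⟨m, ?_, hm⟩
  have h4 : Tendsto (fun x => (2 * y.N x - y.κ x) * (y.r x * y.U x) - y.w x * (1 - y.w x ^ 2)) atTop
      (𝓝 (0 - m * (1 - m ^ 2))) :=
    (tendsto_zero_mul_of_bounded (fun x hx => h.abs_coeff_le hE hx) hz).sub
      (hm.mul ((hm.pow 2).const_sub 1))
  have h5 := deriv_limit_eq_zero (T := 1) (fun x hx => h.drU (by linarith)) hz h4
  have h6 : m * ((1 - m) * (1 + m)) = 0 := by linarith
  rcases mul_eq_zero.1 h6 with h7 | h7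
  · exact Or.inl h7
  · rcases mul_eq_zero.1 h7 with h8 | h8
    · exact Or.inr (Or.inl (by linarith))
    · exact Or.inr (Or.inr (by linarith))

/-- If `r₀ ≥ 1` then `r` is nondecreasing. -/
lemma one_le_r_and_N_nonneg (hr₀ : 1 ≤ r₀) {s : ℝ} (hs : 0 ≤ s) : 1 ≤ y.r s ∧ 0 ≤ y.N s := by
  have hne : ∀ x ∈ forwardInterval ⊤, y.r x ^ 2 ≠ 0 := fun x hx =>
    pow_ne_zero 2 (h.r_pos x hx).ne'
  -- The squared distance to the quadrant `{r ≥ 1, N ≥ 0}` starts at zero and grows at most linearly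
  -- in itself, since `V ≤ 1 / r²`. The initial point lies on the boundary `N = 0`, so a strict
  -- barrier is not available.
  have key := nonneg_of_linear_forward (b := ⊤)
    (f := fun x => -(min (y.r x - 1) 0 ^ 2 + min (y.N x) 0 ^ 2))
    (a := fun x => y.r x + (y.r x + 1) / y.r x ^ 2)
    (mem_forwardInterval_top.2 le_rfl) hs (mem_forwardInterval_top.2 hs)
    (fun x hx =>
      (((hasDerivAt_min_zero_sq (y.r x - 1)).comp_hasDerivWithinAt x
        ((h.deriv_r x hx).sub_const 1)).add
      ((hasDerivAt_min_zero_sq (y.N x)).comp_hasDerivWithinAt x (h.deriv_N x hx))).neg)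
    (h.cont_r.add ((h.cont_r.add continuousOn_const).div (h.cont_r.pow 2) hne)) ?_ ?_
  · have h1 := sq_nonneg (min (y.r s - 1) 0)
    have h2 := sq_nonneg (min (y.N s) 0)
    have h3 : min (y.r s - 1) 0 = 0 := by
      rw [← sq_eq_zero_iff]; linarith
    have h4 : min (y.N s) 0 = 0 := by
      rw [← sq_eq_zero_iff]; linarith
    exact ⟨by linarith [min_eq_right_iff.1 h3], min_eq_right_iff.1 h4⟩
  · simp only [h.init_r, h.init_N, min_self]
    rw [min_eq_right (by linarith)]; simp
  · intro x hx _ _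
    have hr := h.r_pos x hx
    have hκ := h.κ_nonneg hx
    have hV := Variables.V_le hr le_rfl (h.abs_w_le_one hE hw hx.1)
    set p := min (y.r x - 1) 0 with hp
    set q := min (y.N x) 0 with hq
    set g := (y.r x + 1) / y.r x ^ 2 with hg
    have hg0 : 0 < g := by positivity
    have hp0 : p ≤ 0 := min_le_right _ _
    have hq0 : q ≤ 0 := min_le_right _ _
    have hp1 : p ≤ y.r x - 1 := min_le_left _ _
    have hq1 : q ≤ y.N x := min_le_left _ _
    have hqN : q * y.N x = q ^ 2 := by
      rcases le_total (y.N x) 0 with hN | hN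
      · rw [hq, min_eq_left hN]; ring
      · rw [hq, min_eq_right hN]; ring
    have e1 : 1 - 1 / y.r x ^ 2 = g * (y.r x - 1) := by rw [hg]; field_simp; ring
    have h1 : p * (y.r x * y.N x) ≤ y.r x * (p * q) := by
      have := mul_nonneg hr.le (mul_nonneg (neg_nonneg.2 hp0) (sub_nonneg.2 hq1))
      nlinarith
    have h2 : q * (1 - (1 - y.w x ^ 2) ^ 2 / y.r x ^ 2) ≤ g * (p * q) := by
      have h3 : g * p ≤ 1 - (1 - y.w x ^ 2) ^ 2 / y.r x ^ 2 := by
        have : g * p ≤ g * (y.r x - 1) := mul_le_mul_of_nonneg_left hp1 hg0.le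
        simp only [Variables.V] at hV
        linarith
      nlinarith
    have h4 : 0 ≤ y.κ x * q ^ 2 := by positivity
    have h5 : y.r x * (2 * (p * q)) ≤ y.r x * (p ^ 2 + q ^ 2) :=
      mul_le_mul_of_nonneg_left (by nlinarith [sq_nonneg (p - q)]) hr.le
    have h6 : g * (2 * (p * q)) ≤ g * (p ^ 2 + q ^ 2) :=
      mul_le_mul_of_nonneg_left (by nlinarith [sq_nonneg (p - q)]) hg0.le
    have h7 : q * (y.κ x * y.N x) = y.κ x * q ^ 2 := by rw [← hqN]; ring
    linarith

omit hE hw in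
/-- An oscillation criterion: near the cylindrical solution `w` keeps changing sign. -/
lemma infinite_zeros (hw0 : Tendsto y.w atTop (𝓝 0)) (hN : Tendsto y.N atTop (𝓝 0))
    (hκ : Tendsto y.κ atTop (𝓝 1)) : {ρ : ℝ | 0 ≤ ρ ∧ y.w ρ = 0}.Infinite := by
  intro hfin
  obtain ⟨M, hM⟩ := hfin.bddAbove
  set T := max M 0 + 1 with hT
  have hTM : M < T := by linarith [le_max_left M 0]
  have hT0 : 0 < T := by linarith [le_max_right M 0]
  have hne : ∀ x, T ≤ x → y.w x ≠ 0 := fun x hx h0 => by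
    have := hM ⟨by linarith, h0⟩
    linarith
  have hcoef : Tendsto (fun x => 2 * y.N x - y.κ x) atTop (𝓝 (2 * 0 - 1)) :=
    (hN.const_mul 2).sub hκ
  -- `θ = ẇ/w` solves `θ' = aθ - (1 - w²) - θ²` with `a → -1` and `w → 0`. The limiting quadratic
  -- has negative discriminant, so the angle `arctan θ` decreases at a definite rate; `1.2` and
  -- `0.1` leave room for the rate `1/4`.
  have hbot : Tendsto (fun x => Real.arctan (y.r x * y.U x / y.w x)) atTop atBot := by
    refine tendsto_atBot_of_hasDeriv (T := T) (c := 1 / 4) (by norm_num) (fun x hx =>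
      ((h.drU (by linarith)).div (h.dw (by linarith)) (hne x hx)).arctan) ?_
    filter_upwards [eventually_ge_atTop T,
      hcoef.eventually_const_le (show (-1.2 : ℝ) < 2 * 0 - 1 by norm_num),
      hcoef.eventually_le_const (show (2 * 0 - 1 : ℝ) < 1.2 by norm_num),
      (hw0.pow 2).eventually_le_const (show (0 : ℝ) ^ 2 < 0.1 by norm_num)] with x hx h1 h2 h3
    have hwx := hne x hx
    set θ := y.r x * y.U x / y.w x with hθ
    set a := 2 * y.N x - y.κ x
    have e : (((a * (y.r x * y.U x) - y.w x * (1 - y.w x ^ 2)) * y.w x -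
        y.r x * y.U x * (y.r x * y.U x)) / y.w x ^ 2) = a * θ - (1 - y.w x ^ 2) - θ ^ 2 := by
      rw [hθ]; field_simp
    rw [e, div_mul_eq_mul_div, one_mul, div_le_iff₀ (by positivity)]
    change _ ≤ -(1 / 4) * (1 + θ ^ 2)
    nlinarith [sq_nonneg (θ - 2 / 3 * a), mul_nonneg (show 0 ≤ a + 1.2 by linarith)
      (show 0 ≤ 1.2 - a by linarith)]
  obtain ⟨x, hx⟩ := (hbot.eventually_lt_atBot (-(Real.pi / 2))).exists
  linarith [Real.neg_pi_div_two_lt_arctan (y.r x * y.U x / y.w x)]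

/-- Global solutions with bounded `r` are asymptotically cylindrical. -/
lemma isAsymptoticallyCylindrical {l : ℝ}
    (hl : Tendsto (fun x => Real.log (y.r x) - y.ζ x ^ 2) atTop (𝓝 l)) :
    IsAsymptoticallyCylindrical r₀ ⊤ y := by
  have hζ := h.tendsto_ζ
  have hlog : Tendsto (fun x => Real.log (y.r x)) atTop (𝓝 l) := by
    simpa using hl.add (hζ.pow 2)
  set R := Real.exp l with hR
  have hR0 : 0 < R := Real.exp_pos l
  have hr : Tendsto y.r atTop (𝓝 R) := by
    refine ((Real.continuous_exp.tendsto l).comp hlog).congr' ?_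
    filter_upwards [eventually_ge_atTop 0] with x hx
    exact Real.exp_log (h.r_pos' hx)
  obtain ⟨T', hT'⟩ := eventually_atTop.1 (hr.eventually_const_le (show R / 2 < R by linarith))
  set T := max T' 1 with hTdef
  have hT1 : 1 ≤ T := le_max_right _ _
  have hrT : ∀ x, T ≤ x → R / 2 ≤ y.r x := fun x hx => hT' x ((le_max_left _ _).trans hx)
  set K := 5 + 3 * y.ζ 0 with hK
  have hK0 : 0 < K := by have := h.ζ_zero_nonneg; positivity
  have hκK : ∀ x, 0 ≤ x → |y.κ x| ≤ K := fun x hx => by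
    rw [abs_of_nonneg (h.κ_nonneg' hx)]; exact h.κ_le hE hx
  have hN : Tendsto y.N atTop (𝓝 0) := by
    have h1 : Tendsto (fun x => y.N x + y.ζ x ^ 2) atTop (𝓝 0) := by
      refine tendsto_zero_of_barbalat (T := T)
        (C := 1 / (R / 2) ^ 2 + K * K + 2 * K * y.ζ 0 ^ 2)
        (fun x hx => (h.dlogr (by linarith)).sub (h.dζsq (by linarith)))
        (fun x hx => (h.dN (by linarith)).add (h.dζsq (by linarith)))
        (fun x hx => by linarith [h.N_ge_neg_ζsq hE (hT1.trans hx)]) (fun x hx => ?_)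
        (fun x hx => ?_) hl
      · nlinarith [h.half_le_κ' (hT1.trans hx), sq_nonneg (y.ζ x)]
      · have hx0 : 0 ≤ x := by linarith
        have h1 := Variables.V_le (by positivity) (hrT x hx) (h.abs_w_le_one hE hw hx0)
        have h2 := (abs_le.1 (hκK x hx0)).2
        have h3 := h.ζ_sq_le (mem_forwardInterval_top.2 hx0)
        have h4 : y.κ x * y.N x ≤ K * K := by
          refine (le_abs_self _).trans ?_
          rw [abs_mul]
          exact mul_le_mul (hκK x hx0) (h.abs_N_le hE hx0) (abs_nonneg _) hK0.le
        have h5 : y.κ x * y.ζ x ^ 2 ≤ K * y.ζ 0 ^ 2 :=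
          mul_le_mul h2 h3 (sq_nonneg _) hK0.le
        linarith
    simpa using h1.sub (hζ.pow 2)
  obtain ⟨T₂', hT₂'⟩ := eventually_atTop.1
    (hN.eventually_le_const (show (0 : ℝ) < 1 / 8 by norm_num))
  set T₂ := max T₂' 1 with hT₂def
  have hT₂1 : 1 ≤ T₂ := le_max_right _ _
  have hde : ∀ x, T₂ ≤ x → HasDerivAt (fun x => -y.energy x)
      (-(4 * (2 * y.N x - y.κ x) * (y.r x * y.U x) ^ 2)) x := fun x hx =>
    (h.denergy (by linarith)).neg
  -- `N ≤ 1/8` and `κ ≥ 1/2` give `4(2N - κ) ≤ -1`.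
  have hde' : ∀ x, T₂ ≤ x → (y.r x * y.U x) ^ 2 ≤
      -(4 * (2 * y.N x - y.κ x) * (y.r x * y.U x) ^ 2) := by
    intro x hx
    have h1 := hT₂' x ((le_max_left _ _).trans hx)
    have h2 := h.half_le_κ' (hT₂1.trans hx)
    nlinarith [sq_nonneg (y.r x * y.U x)]
  have hpot : ∀ x, 0 ≤ x → (1 - y.w x ^ 2) ^ 2 ≤ 1 := fun x hx => by
    have := h.w_sq_le_one hE hw hx
    nlinarith [sq_nonneg (y.w x)]
  obtain ⟨L, hL⟩ := exists_tendsto_of_deriv_nonneg (C := 1) hde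
    (fun x hx => (sq_nonneg _).trans (hde' x hx)) (fun x hx => by
      have := hpot x (by linarith)
      simp only [Variables.energy]
      nlinarith [sq_nonneg (y.r x * y.U x)])
  have hz : Tendsto (fun x => y.r x * y.U x) atTop (𝓝 0) := by
    refine h.tendsto_rU hE hw (B := y.energy T₂ + 1) hT₂1 (fun x hx => ?_) hde hde' hL
    have h1 := le_of_hasDeriv_nonneg (f := fun x => -y.energy x) hx
      (hasDerivWithinAt_Icc_of_le hde le_rfl)
      (fun z hz => (sq_nonneg _).trans (hde' z hz.1))
    have h2 := hpot x (by linarith)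
    have h3 : y.energy x = 2 * (y.r x * y.U x) ^ 2 - (1 - y.w x ^ 2) ^ 2 := rfl
    nlinarith [sq_nonneg (y.r x * y.U x)]
  obtain ⟨m, hm, hwm⟩ := h.w_limit hE hw (L := -L) hz (by simpa using hL.neg)
  -- `N` and `N'` both converge, so the limit of `N'` vanishes; this excludes `m = ±1` and fixes
  -- `R`.
  have hVlim : 1 - (1 - m ^ 2) ^ 2 / R ^ 2 - 0 = 0 := by
    refine deriv_limit_eq_zero (T := 1) (fun x hx => h.dN (by linarith)) hN ?_
    exact (((((hwm.pow 2).const_sub 1).pow 2).div (hr.pow 2) (by positivity)).const_sub 1).sub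
      (tendsto_zero_mul_of_bounded hκK hN)
  obtain ⟨rfl, hR1⟩ : m = 0 ∧ R = 1 := by
    rcases hm with rfl | rfl | rfl
    · refine ⟨rfl, ?_⟩
      field_simp at hVlim
      nlinarith
    · norm_num at hVlim
    · norm_num at hVlim
  rw [hR1] at hr
  have hU : Tendsto y.U atTop (𝓝 0) := by
    have := hz.div hr one_ne_zero
    rw [zero_div] at this
    refine this.congr' ?_
    filter_upwards [eventually_ge_atTop 0] with x hx
    simp only [Pi.div_apply]
    exact mul_div_cancel_left₀ _ (h.r_pos' hx).ne'
  have hκ : Tendsto y.κ atTop (𝓝 1) := by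
    refine tendsto_one_of_riccati (T := 1) (g := fun x => 1 + 2 * y.U x ^ 2)
      (fun x hx => h.dκ (by linarith)) (fun x hx => h.κ_nonneg' (by linarith)) ?_
    simpa using ((hU.pow 2).const_mul 2).const_add 1
  refine ⟨rfl, fun ρ hρ => h.abs_w_le_one hE hw hρ, hr, hN, hζ, hκ, ?_⟩
  rcases le_or_gt 1 r₀ with hr₀ | hr₀
  · left
    have hrone : ∀ x, 0 ≤ x → y.r x = 1 := by
      intro x hx
      refine le_antisymm (ge_of_tendsto hr ?_) (h.one_le_r_and_N_nonneg hE hw hr₀ hx).1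
      filter_upwards [eventually_ge_atTop x] with z hz
      have hI := Icc_subset_forwardInterval hx (mem_forwardInterval_top.2 (hx.trans hz))
      exact le_of_hasDeriv_nonneg hz (fun t ht => (h.deriv_r t (hI ht)).mono hI)
        (fun t ht => mul_nonneg (h.r_pos t (hI ht)).le
          (h.one_le_r_and_N_nonneg hE hw hr₀ (hI ht).1).2)
    have huniq : UniqueDiffOn ℝ (forwardInterval ⊤) := by
      have : forwardInterval ⊤ = Ici 0 := by ext x; exact mem_forwardInterval_top
      rw [this]; exact uniqueDiffOn_Ici 0
    have hNzero : ∀ x, 0 ≤ x → y.N x = 0 := by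
      intro x hx
      have hx' := mem_forwardInterval_top.2 hx
      have h1 := h.deriv_r x hx'
      have h2 : HasDerivWithinAt y.r 0 (forwardInterval ⊤) x :=
        (hasDerivWithinAt_const x _ (1 : ℝ)).congr
          (fun z hz => hrone z hz.1) (hrone x hx)
      have h3 := (huniq x hx').eq_deriv _ h1 h2
      rwa [hrone x hx, one_mul] at h3
    intro x hx
    refine ⟨hrone x hx, ?_⟩
    have hx' := mem_forwardInterval_top.2 hx
    have h1 := h.deriv_N x hx'
    have h2 : HasDerivWithinAt y.N 0 (forwardInterval ⊤) x :=
      (hasDerivWithinAt_const x _ (0 : ℝ)).congr (fun z hz => hNzero z hz.1) (hNzero x hx)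
    have h3 := (huniq x hx').eq_deriv _ h1 h2
    rw [hrone x hx, hNzero x hx] at h3
    have h4 := h.w_sq_le_one hE hw hx
    have h5 : y.w x ^ 2 * (2 - y.w x ^ 2) = 0 := by ring_nf at h3 ⊢; linarith
    rcases mul_eq_zero.1 h5 with h6 | h6
    · exact pow_eq_zero_iff two_ne_zero |>.1 h6
    · linarith
  · exact Or.inr ⟨hr₀, hwm, hU, h.infinite_zeros hwm hN hκ⟩

end Global

end IsSolutionOn

end HauntedEYM

/-! ### Unbounded `r`: the flat class. -/

namespace HauntedEYM

open Set

namespace IsSolutionOn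

section Flat

variable {r₀ w₀ U₀ : ℝ} {y : Variables} (h : IsSolutionOn r₀ w₀ U₀ ⊤ y)
include h

lemma dinv_r_sq {x : ℝ} (hx : 0 < x) :
    HasDerivAt (fun x => 1 / y.r x ^ 2) (-2 * (y.N x / y.r x ^ 2)) x := by
  have hr := (h.r_pos' hx.le).ne'
  refine ((hasDerivAt_const x (1 : ℝ)).div ((h.dr hx).pow 2) (pow_ne_zero 2 hr)).congr_deriv ?_
  simp only [Pi.pow_apply]
  field_simp
  simp only [Nat.cast_ofNat, Nat.add_one_sub_one, pow_one]
  ring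

lemma dlam {x : ℝ} (hx : 0 < x) : HasDerivAt (fun x => y.κ x - y.N x)
    (2 * y.U x ^ 2 + y.V x - y.κ x * (y.κ x - y.N x)) x :=
  hasDerivAt_of_forward hx (h.deriv_κ_sub_N (mem_forwardInterval_top.2 hx.le))

/-- If `w` and `U` vanish at some time then `w` has vanished before. -/
lemma w_eq_zero_of_later {s t : ℝ} (hs : 0 ≤ s) (hst : s ≤ t) (hw : y.w t = 0) (hU : y.U t = 0) :
    y.w s = 0 ∧ y.U s = 0 := by
  have hI := Icc_subset_forwardInterval hs (mem_forwardInterval_top.2 (hs.trans hst))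
  have key : ¬ 0 < y.w s ^ 2 + y.U s ^ 2 := by
    intro hpos
    -- Backward uniqueness for the linear system in `(w, U)`: `w² + U²` decays at most exponentially
    -- on `[s, t]`, so it cannot reach zero.
    have := pos_of_linear (f := fun x => y.w x ^ 2 + y.U x ^ 2)
      (a := fun x => -(|y.r x - (1 - y.w x ^ 2) / y.r x| + 2 * (y.κ x - y.N x))) hst
      (fun x hx => (((h.deriv_w x (hI hx)).pow 2).add ((h.deriv_U x (hI hx)).pow 2)).mono hI)
      ?_ hpos fun x hx _ => ?_
    · simp [hw, hU] at this
    · have hq : ContinuousOn (fun x => (1 - y.w x ^ 2) / y.r x) (Icc s t) :=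
        (continuousOn_const.sub ((h.cont_w.mono hI).pow 2)).div (h.cont_r.mono hI)
          (fun x hx => (h.r_pos x (hI hx)).ne')
      exact ((((h.cont_r.mono hI).sub hq).abs).add
        ((((h.cont_κ.sub h.cont_N).mono hI)).const_smul (2 : ℝ))).neg
    · have hr := h.r_pos x (hI hx)
      have hl := h.N_le_κ (hI hx)
      set q := y.r x - (1 - y.w x ^ 2) / y.r x with hq
      have e : y.w x * (1 - y.w x ^ 2) / y.r x = y.w x * (y.r x - q) := by rw [hq]; ring
      rw [e]
      simp only [Nat.cast_ofNat, Nat.add_one_sub_one, pow_one]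
      have h1 : -(2 * (y.w x * y.U x) * q) ≤ (y.w x ^ 2 + y.U x ^ 2) * |q| := by
        refine (neg_le_abs _).trans ?_
        rw [abs_mul]
        refine mul_le_mul_of_nonneg_right ?_ (abs_nonneg q)
        exact abs_le.2 ⟨by nlinarith [sq_nonneg (y.w x + y.U x)],
          by nlinarith [sq_nonneg (y.w x - y.U x)]⟩
      have h2 : 0 ≤ (y.κ x - y.N x) * y.w x ^ 2 := mul_nonneg (by linarith) (sq_nonneg _)
      nlinarith
  have h1 := sq_nonneg (y.w s)
  have h2 := sq_nonneg (y.U s)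
  exact ⟨pow_eq_zero_iff two_ne_zero |>.1 (by linarith), pow_eq_zero_iff two_ne_zero |>.1 (by linarith)⟩

variable (hE : 0 ≤ initialEnergy r₀ w₀ U₀)

/-- Where `N > 1`, also `κ ≥ N > 1`, so `N' ≤ 1 - κN < 0`. -/
lemma N_le_one {s : ℝ} (hs : 0 ≤ s) : y.N s ≤ 1 := by
  have := nonneg_of_linear_forward (b := ⊤) (f := fun x => 1 - y.N x) (a := fun _ => 0)
    (mem_forwardInterval_top.2 le_rfl) hs (mem_forwardInterval_top.2 hs)
    (fun x hx => (h.deriv_N x hx).const_sub 1) continuousOn_const (by simp [h.init_N])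
    fun x hx _ hx1 => ?_
  · linarith
  · have h1 := y.V_nonneg x
    have h2 := h.N_le_κ hx
    simp only [Variables.V] at h1
    nlinarith

include hE

/-- The phantom field does not vanish if `r` grows. -/
lemma ζ_zero_pos {s : ℝ} (hs : 0 ≤ s) (hrs : r₀ < y.r s) : 0 < y.ζ 0 := by
  by_contra hneg
  have h0 : y.ζ 0 = 0 := le_antisymm (not_lt.1 hneg) h.ζ_zero_nonneg
  -- With `ζ ≡ 0`, `N' ≤ (κ - N)N` and `N 0 = 0`; then `r` never exceeds `r₀`.
  have hN : ∀ x, 0 ≤ x → y.N x ≤ 0 := by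
    intro x hx
    have := nonneg_of_linear_forward (b := ⊤) (f := fun x => -y.N x)
      (a := fun x => y.κ x - y.N x)
      (mem_forwardInterval_top.2 le_rfl) hx (mem_forwardInterval_top.2 hx)
      (fun x hx => (h.deriv_N x hx).neg) (h.cont_κ.sub h.cont_N) (by simp [h.init_N])
      fun x hx _ _ => ?_
    · linarith
    · have h1 := h.ζ_sq_le hx
      rw [h.N'_eq hE hx]
      rw [h0] at h1
      nlinarith [sq_nonneg (y.U x)]
  have hI := Icc_subset_forwardInterval le_rfl (mem_forwardInterval_top.2 hs)
  have := le_of_hasDeriv_nonpos hs (fun x hx => (h.deriv_r x (hI hx)).mono hI)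
    (fun x hx => mul_nonpos_of_nonneg_of_nonpos (h.r_pos x (hI hx)).le (hN x hx.1))
  rw [h.init_r] at this
  linarith

variable (hw : |w₀| ≤ 1) (hr : Tendsto y.r atTop atTop)
include hw hr

lemma tendsto_V : Tendsto y.V atTop (𝓝 0) := by
  refine tendsto_of_tendsto_of_tendsto_of_le_of_le' tendsto_const_nhds
    ((tendsto_const_nhds (x := (1 : ℝ))).div_atTop ((tendsto_pow_atTop two_ne_zero).comp hr))
    (Eventually.of_forall y.V_nonneg) ?_
  filter_upwards [eventually_ge_atTop 0] with x hx
  exact Variables.V_le (h.r_pos' hx) le_rfl (h.abs_w_le_one hE hw hx)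

/-- Once `V ≤ 1/2`, `N' ≥ 1/4` holds as long as `N < 1 / (4K)`, since `κ ≤ K`. -/
lemma exists_le_N : ∃ c > 0, ∃ T, 1 ≤ T ∧ ∀ x, T ≤ x → c ≤ y.N x := by
  set K := 5 + 3 * y.ζ 0 with hK
  have hK0 : 0 < K := by have := h.ζ_zero_nonneg; positivity
  obtain ⟨T', hT'⟩ := eventually_atTop.1
    ((h.tendsto_V hE hw hr).eventually_le_const (show (0 : ℝ) < 1 / 2 by norm_num))
  set T := max T' 1 with hTdef
  have hT1 : 1 ≤ T := le_max_right _ _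
  have hder : ∀ x, T ≤ x → y.N x < 1 / (4 * K) → 1 / 4 ≤ 1 - y.V x - y.κ x * y.N x := by
    intro x hx hN
    have h1 := hT' x ((le_max_left _ _).trans hx)
    have h2 := h.κ_nonneg' (show 0 ≤ x by linarith)
    have h3 := h.κ_le hE (show 0 ≤ x by linarith)
    have h4 : y.κ x * y.N x ≤ K * (1 / (4 * K)) :=
      (mul_le_mul_of_nonneg_left hN.le h2).trans (mul_le_mul_of_nonneg_right h3 (by positivity))
    have h5 : K * (1 / (4 * K)) = 1 / 4 := by field_simp
    linarith
  obtain ⟨s, hs, hsN⟩ : ∃ s, T ≤ s ∧ 1 / (4 * K) ≤ y.N s := by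
    by_contra! hcon
    have htop : Tendsto y.N atTop atTop :=
      tendsto_atTop_of_hasDeriv (T := T) (c := 1 / 4) (by norm_num)
        (fun x hx => h.dN (by linarith))
        ((eventually_ge_atTop T).mono fun x hx => hder x hx (hcon x hx))
    obtain ⟨x, hx, hx1⟩ :=
      ((htop.eventually_ge_atTop (1 / (4 * K))).and (eventually_ge_atTop T)).exists
    linarith [hcon x hx1]
  refine ⟨1 / (4 * K), by positivity, s, hT1.trans hs, fun x hx => ?_⟩
  have := nonneg_of_linear (f := fun x => y.N x - 1 / (4 * K)) (a := fun _ => 0) hx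
    (hasDerivWithinAt_Icc_of_le (T := s) (fun z hz => (h.dN (by linarith)).sub_const _) le_rfl)
    continuousOn_const (by linarith)
    (fun z hz hz0 => by linarith [hder z (hs.trans hz.1) (by linarith)])
  linarith

/-- Global solutions with unbounded `r` are asymptotically flat. -/
lemma isAsymptoticallyFlat : IsAsymptoticallyFlat r₀ ⊤ y := by
  set K := 5 + 3 * y.ζ 0 with hK
  have hK0 : 0 < K := by have := h.ζ_zero_nonneg; positivity
  have hV := h.tendsto_V hE hw hr
  have hζ := h.tendsto_ζ
  obtain ⟨c, hc, T, hT1, hNc⟩ := h.exists_le_N hE hw hr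
  have hVr : ∀ x, 0 ≤ x → y.V x ≤ 1 / y.r x ^ 2 := fun x hx =>
    Variables.V_le (h.r_pos' hx) le_rfl (h.abs_w_le_one hE hw hx)
  have hpot : ∀ x, 0 ≤ x → (1 - y.w x ^ 2) ^ 2 ≤ 1 := fun x hx => by
    have := h.w_sq_le_one hE hw hx
    nlinarith [sq_nonneg (y.w x)]
  -- a potential for `1 / r²`
  set Φ : ℝ → ℝ := fun x => 1 / (2 * c) * (1 / y.r x ^ 2) with hΦ
  have hΦ0 : ∀ x, 0 ≤ x → 0 ≤ Φ x := fun x hx => by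
    have := h.r_pos' hx; simp only [hΦ]; positivity
  have hdΦ : ∀ x, T ≤ x → HasDerivAt Φ (1 / (2 * c) * (-2 * (y.N x / y.r x ^ 2))) x := fun x hx =>
    (h.dinv_r_sq (by linarith)).const_mul _
  have hΦ' : ∀ x, T ≤ x → 1 / (2 * c) * (-2 * (y.N x / y.r x ^ 2)) ≤ -(1 / y.r x ^ 2) := by
    intro x hx
    have h1 := hNc x hx
    have h2 := h.r_pos' (show 0 ≤ x by linarith)
    have e : 1 / (2 * c) * (-2 * (y.N x / y.r x ^ 2)) = -((y.N x / c) / y.r x ^ 2) := by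
      field_simp
    rw [e, neg_le_neg_iff]
    gcongr
    rwa [le_div_iff₀ hc, one_mul]
  -- The constraint reads `κ' = ζ² + V - (κ - N)²`. Adding `Φ` and `ζ²` to `κ` compensates `V` and
  -- `ζ²`, so minus the sum is bounded above with derivative at least `(κ - N)²`, and Barbalat
  -- applies.
  have hlam : Tendsto (fun x => y.κ x - y.N x) atTop (𝓝 0) := by
    have hdF : ∀ x, T ≤ x → HasDerivAt (fun x => -(y.κ x + Φ x + y.ζ x ^ 2))
        (-(1 + 2 * y.U x ^ 2 - y.κ x ^ 2 + 1 / (2 * c) * (-2 * (y.N x / y.r x ^ 2)) +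
          -2 * y.κ x * y.ζ x ^ 2)) x := fun x hx =>
      (((h.dκ (by linarith)).add (hdΦ x hx)).add (h.dζsq (by linarith))).neg
    have hF' : ∀ x, T ≤ x → (y.κ x - y.N x) ^ 2 ≤
        -(1 + 2 * y.U x ^ 2 - y.κ x ^ 2 + 1 / (2 * c) * (-2 * (y.N x / y.r x ^ 2)) +
          -2 * y.κ x * y.ζ x ^ 2) := by
      intro x hx
      have h1 := hΦ' x hx
      have h2 := hVr x (by linarith)
      have h3 := h.constraint' hE (show 0 ≤ x by linarith)
      have h4 := h.half_le_κ' (hT1.trans hx)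
      have h5 := mul_le_mul_of_nonneg_right h4 (sq_nonneg (y.ζ x))
      linarith
    obtain ⟨l, hl⟩ := exists_tendsto_of_deriv_nonneg (C := 0) hdF
      (fun x hx => (sq_nonneg _).trans (hF' x hx)) (fun x hx => by
        have hx0 : 0 ≤ x := by linarith
        linarith [h.κ_nonneg' hx0, hΦ0 x hx0, sq_nonneg (y.ζ x)])
    have h1 : Tendsto (fun x => (y.κ x - y.N x) ^ 2) atTop (𝓝 0) := by
      refine tendsto_zero_of_barbalat (C := 2 * (K * K ^ 2)) hdF
        (fun x hx => (h.dlam (by linarith)).pow 2) (fun x _ => sq_nonneg _) hF' (fun x hx => ?_) hl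
      have hx0 : 0 ≤ x := by linarith
      have h2 := h.N_le_κ' hx0
      have h3 := h.κ_le hE hx0
      have h4 := h.κ_nonneg' hx0
      have h5 := hNc x hx
      have h6 := y.V_nonneg x
      have h7 : (y.κ x - y.N x) ^ 2 ≤ K ^ 2 := pow_le_pow_left₀ (by linarith) (by linarith) 2
      have h8 : y.κ x * (y.κ x - y.N x) ^ 2 ≤ K * K ^ 2 :=
        mul_le_mul h3 h7 (sq_nonneg _) hK0.le
      have h9 : 0 ≤ (y.κ x - y.N x) * (2 * y.U x ^ 2 + y.V x) :=
        mul_nonneg (by linarith) (by positivity)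
      simp only [Nat.cast_ofNat, Nat.add_one_sub_one, pow_one]
      linarith
    have := h1.sqrt
    simp only [Real.sqrt_sq_eq_abs, Real.sqrt_zero] at this
    exact (tendsto_zero_iff_abs_tendsto_zero _).2 this
  have hN : Tendsto y.N atTop (𝓝 1) := by
    refine tendsto_one_of_riccati (T := T) (g := fun x => 1 - y.V x - y.N x * (y.κ x - y.N x))
      (fun x hx => (h.dN (by linarith)).congr_deriv (by ring))
      (fun x hx => hc.le.trans (hNc x hx)) ?_
    have := (hV.const_sub 1).sub
      (tendsto_zero_mul_of_bounded (fun x hx => h.abs_N_le hE hx) hlam)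
    simpa using this
  have hκ : Tendsto y.κ atTop (𝓝 1) := by simpa using hlam.add hN
  -- the energy is eventually increasing
  have hcoef : Tendsto (fun x => 2 * y.N x - y.κ x) atTop (𝓝 (2 * 1 - 1)) :=
    (hN.const_mul 2).sub hκ
  obtain ⟨T₂', hT₂'⟩ := eventually_atTop.1 ((hcoef.eventually_const_le
    (show (1 / 4 : ℝ) < 2 * 1 - 1 by norm_num)).and (hr.eventually_ge_atTop 1))
  set T₂ := max T₂' T with hT₂def
  have hTT₂ : T ≤ T₂ := le_max_right _ _
  have hT₂ : ∀ x, T₂ ≤ x → 1 / 4 ≤ 2 * y.N x - y.κ x ∧ 1 ≤ y.r x := fun x hx =>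
    hT₂' x ((le_max_left _ _).trans hx)
  have hde : ∀ x, T₂ ≤ x → HasDerivAt y.energy
      (4 * (2 * y.N x - y.κ x) * (y.r x * y.U x) ^ 2) x := fun x hx => h.denergy (by linarith)
  have hde' : ∀ x, T₂ ≤ x → (y.r x * y.U x) ^ 2 ≤
      4 * (2 * y.N x - y.κ x) * (y.r x * y.U x) ^ 2 := fun x hx => by
    nlinarith [(hT₂ x hx).1, sq_nonneg (y.r x * y.U x)]
  have hemono : ∀ s t, T₂ ≤ s → s ≤ t → y.energy s ≤ y.energy t := fun s t hs hst =>
    le_of_hasDeriv_nonneg hst (hasDerivWithinAt_Icc_of_le hde hs)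
      (fun z hz => (sq_nonneg _).trans (hde' z (hs.trans hz.1)))
  have hedef : ∀ x, y.energy x = 2 * (y.r x * y.U x) ^ 2 - (1 - y.w x ^ 2) ^ 2 := fun _ => rfl
  -- A positive energy would persist and keep `|ẇ|` away from zero with constant sign, driving `w`
  -- out of `[-1, 1]`.
  have he0 : ∀ t, T₂ ≤ t → y.energy t ≤ 0 := by
    intro t ht
    by_contra! hpos
    have hz2 : ∀ x, t ≤ x → y.energy t / 2 ≤ (y.r x * y.U x) ^ 2 := fun x hx => by
      nlinarith [hemono t x ht hx, hedef x, sq_nonneg (1 - y.w x ^ 2)]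
    have hη : 0 < √(y.energy t / 2) := Real.sqrt_pos.2 (by linarith)
    have hne : ∀ x ∈ Ici t, y.r x * y.U x ≠ 0 := fun x hx h0 => by
      have := hz2 x hx
      rw [h0] at this
      norm_num at this
      linarith
    have hcont : ContinuousOn (fun x => y.r x * y.U x) (Ici t) := fun x hx =>
      (h.drU (by linarith [mem_Ici.1 hx])).continuousAt.continuousWithinAt
    rcases isPreconnected_Ici.mapsTo_Ioi_or_Iio hcont hne with hs | hs
    · have htop : Tendsto y.w atTop atTop := by
        refine tendsto_atTop_of_hasDeriv (T := t) hη (fun x hx => h.dw (by linarith)) ?_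
        filter_upwards [eventually_ge_atTop t] with x hx
        exact Real.sqrt_le_iff.2 ⟨(hs hx).le, hz2 x hx⟩
      obtain ⟨x, hx, hx0⟩ := ((htop.eventually_gt_atTop 1).and (eventually_ge_atTop 0)).exists
      linarith [(abs_le.1 (h.abs_w_le_one hE hw hx0)).2]
    · have hbot : Tendsto y.w atTop atBot := by
        refine tendsto_atBot_of_hasDeriv (T := t) hη (fun x hx => h.dw (by linarith)) ?_
        filter_upwards [eventually_ge_atTop t] with x hx
        rw [le_neg]
        refine Real.sqrt_le_iff.2 ⟨?_, by rw [neg_sq]; exact hz2 x hx⟩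
        have := mem_Iio.1 (hs hx)
        linarith
      obtain ⟨x, hx, hx0⟩ := ((hbot.eventually_lt_atBot (-1)).and (eventually_ge_atTop 0)).exists
      linarith [(abs_le.1 (h.abs_w_le_one hE hw hx0)).1]
  obtain ⟨L, hL⟩ := exists_tendsto_of_deriv_nonneg (C := 0) hde
    (fun x hx => (sq_nonneg _).trans (hde' x hx)) he0
  have hz : Tendsto (fun x => y.r x * y.U x) atTop (𝓝 0) :=
    h.tendsto_rU hE hw (B := 1) (hT1.trans hTT₂) (fun x hx => by
      nlinarith [he0 x hx, hedef x, hpot x (by linarith), sq_nonneg (y.r x * y.U x)]) hde hde' hL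
  obtain ⟨m, hm, hwm⟩ := h.w_limit hE hw hz hL
  have hζ0 : 0 < y.ζ 0 := by
    obtain ⟨s, hs, hs0⟩ := ((hr.eventually_gt_atTop r₀).and (eventually_ge_atTop 0)).exists
    exact h.ζ_zero_pos hE hs0 hs
  have hζpos : ∀ x, 0 ≤ x → 0 < y.ζ x := fun x hx => by
    have hI := Icc_subset_forwardInterval le_rfl (mem_forwardInterval_top.2 hx)
    exact pos_of_linear (a := fun x => -y.κ x) hx (fun t ht => (h.deriv_ζ t (hI ht)).mono hI)
      (h.cont_κ.neg.mono hI) hζ0 (fun t ht _ => le_rfl)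
  refine ⟨rfl, fun ρ hρ => h.abs_w_le_one hE hw hρ, hr, ?_, ?_, hκ, ?_⟩
  · have hm0 : ∀ x, T ≤ x → 0 ≤ y.r x * (1 - y.N x ^ 2) := fun x hx => by
      have h1 := h.N_le_one (show 0 ≤ x by linarith)
      have h2 := hNc x hx
      exact mul_nonneg (h.r_pos' (by linarith)).le (by nlinarith)
    have hinv : Tendsto (fun x => 2 / y.r x) atTop (𝓝 0) := tendsto_const_nhds.div_atTop hr
    obtain ⟨β, hβ⟩ :
        ∃ β, Tendsto (fun x => y.r x * (1 - y.N x ^ 2) + 2 / y.r x) atTop (𝓝 β) := by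
      -- The term `2 / r` tends to zero and contributes the `-2` in the bracket; nonpositive energy
      -- gives `2ẇ² ≤ (1 - w²)² ≤ 1`, so the bracket is nonpositive.
      refine exists_tendsto_of_deriv_nonpos (T := T₂) (C := 0)
        (f' := fun x => y.N x / y.r x * (2 * (y.r x * y.U x) ^ 2 + (1 - y.w x ^ 2) ^ 2 - 2) -
          y.r x * y.N x * y.ζ x ^ 2) (fun x hx => ?_) (fun x hx => ?_) (fun x hx => ?_)
      · have hrx := (h.r_pos' (show 0 ≤ x by linarith)).ne'
        refine (((h.dr (by linarith)).mul (((h.dN (by linarith)).pow 2).const_sub 1)).add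
          ((hasDerivAt_const x (2 : ℝ)).div (h.dr (by linarith)) hrx)).congr_deriv ?_
        have h1 := h.constraint' hE (show 0 ≤ x by linarith)
        rw [h1]
        simp only [Variables.V, Pi.pow_apply]
        field_simp
        ring
      · have hx0 : 0 ≤ x := by linarith
        have h1 := h.r_pos' hx0
        have h2 := hNc x (hTT₂.trans hx)
        have h3 : 0 ≤ y.r x * y.N x * y.ζ x ^ 2 :=
          mul_nonneg (mul_nonneg h1.le (by linarith)) (sq_nonneg _)
        have h4 : 2 * (y.r x * y.U x) ^ 2 + (1 - y.w x ^ 2) ^ 2 - 2 ≤ 0 := by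
          linarith [he0 x hx, hedef x, hpot x hx0]
        have h5 : 0 ≤ y.N x / y.r x := div_nonneg (by linarith) h1.le
        linarith [mul_nonpos_of_nonneg_of_nonpos h5 h4]
      · have h1 := h.r_pos' (show 0 ≤ x by linarith)
        have := hm0 x (hTT₂.trans hx)
        positivity
    have hβ' : Tendsto (fun x => y.r x * (1 - y.N x ^ 2)) atTop (𝓝 β) := by
      simpa using hβ.sub hinv
    exact ⟨β, ge_of_tendsto hβ' ((eventually_ge_atTop T).mono hm0), hβ'⟩
  · have hpos : ∀ x, 0 ≤ x → 0 < y.r x * y.ζ x := fun x hx =>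
      mul_pos (h.r_pos' hx) (hζpos x hx)
    have hd : ∀ x, T₂ ≤ x → HasDerivAt (fun x => y.r x * y.ζ x)
        (-(y.κ x - y.N x) * (y.r x * y.ζ x)) x := fun x hx =>
      ((h.dr (by linarith)).mul (h.dζ (by linarith))).congr_deriv (by ring)
    obtain ⟨α, hα⟩ := exists_tendsto_of_deriv_nonpos (C := 0) hd (fun x hx => by
      have hx0 : 0 ≤ x := by linarith
      have h1 := hpos x hx0
      have h2 := h.N_le_κ' hx0
      exact mul_nonpos_of_nonpos_of_nonneg (by linarith) h1.le)
      (fun x hx => (hpos x (by linarith)).le)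
    refine ⟨α, ?_, hα⟩
    -- Positivity of `α` means integrability of `κ - N`. In `G'` the term `2κ(κ - N)` beats `-(κ -
    -- N)`, while the energy and `Φ` pay for `-4U²` and `-2V`; all corrections are nonpositive, so
    -- `G` bounds `log (rζ)` from below.
    set G : ℝ → ℝ := fun x => Real.log (y.r x * y.ζ x) + 4 * y.energy x - 2 * Φ x -
      2 * (y.κ x - y.N x) with hG
    have hGmono : ∀ x, T₂ ≤ x → G T₂ ≤ G x := by
      intro x hx
      refine le_of_hasDeriv_nonneg hx (hasDerivWithinAt_Icc_of_le (T := T₂) (fun z hz =>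
        ((((hd z hz).log (hpos z (by linarith)).ne').add ((hde z hz).const_mul 4)).sub
          ((hdΦ z (hTT₂.trans hz)).const_mul 2)).sub ((h.dlam (by linarith)).const_mul 2)) le_rfl)
        fun z hz => ?_
      have hz0 : 0 ≤ z := by linarith [hz.1]
      have h1 := hΦ' z (hTT₂.trans hz.1)
      have h2 := hde' z hz.1
      have h3 := hVr z hz0
      have h4 := h.half_le_κ' (hT1.trans (hTT₂.trans hz.1))
      have h5 := h.N_le_κ' hz0
      have h6 := (hT₂ z hz.1).2
      have h7 : y.U z ^ 2 ≤ (y.r z * y.U z) ^ 2 := by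
        rw [mul_pow]; exact le_mul_of_one_le_left (sq_nonneg _) (one_le_pow₀ h6)
      rw [mul_div_cancel_right₀ _ (hpos z hz0).ne']
      have h8 := mul_le_mul_of_nonneg_right h4 (show 0 ≤ y.κ z - y.N z by linarith)
      linarith
    refine (Real.exp_pos (G T₂)).trans_le (ge_of_tendsto hα ?_)
    filter_upwards [eventually_ge_atTop T₂] with x hx
    have hx0 : 0 ≤ x := by linarith
    rw [← Real.le_log_iff_exp_le (hpos x hx0)]
    have h1 := hGmono x hx
    have h2 := he0 x hx
    have h3 := hΦ0 x hx0
    have h4 := h.N_le_κ' hx0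
    have h5 : G x = Real.log (y.r x * y.ζ x) + 4 * y.energy x - 2 * Φ x -
      2 * (y.κ x - y.N x) := rfl
    linarith
  · rcases hm with rfl | rfl | rfl
    · left
      have hL1 : L = -1 := by
        have h1 : Tendsto y.energy atTop (𝓝 (2 * 0 ^ 2 - (1 - 0 ^ 2) ^ 2)) :=
          ((hz.pow 2).const_mul 2).sub (((hwm.pow 2).const_sub 1).pow 2)
        have := tendsto_nhds_unique hL h1
        norm_num at this
        exact this
      -- The energy increases to `-1`, its least possible value when `|w| ≤ 1`, so it equals `-1`
      -- from `T₂` on.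
      have hlate : ∀ x, T₂ ≤ x → y.w x = 0 ∧ y.U x = 0 := by
        intro x hx
        have hx0 : 0 ≤ x := by linarith
        have h1 : y.energy x ≤ -1 := by
          rw [← hL1]
          exact ge_of_tendsto hL ((eventually_ge_atTop x).mono fun t ht => hemono x t hx ht)
        have h2 := hpot x hx0
        have h3 := hedef x
        have h4 := h.w_sq_le_one hE hw hx0
        have h5 := sq_nonneg (y.r x * y.U x)
        have h6 : (y.r x * y.U x) ^ 2 = 0 := by linarith
        have h7 : y.w x ^ 2 = 0 := by nlinarith [sq_nonneg (y.w x)]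
        refine ⟨pow_eq_zero_iff two_ne_zero |>.1 h7, ?_⟩
        exact (mul_eq_zero.1 (pow_eq_zero_iff two_ne_zero |>.1 h6)).resolve_left (h.r_pos' hx0).ne'
      have hall : ∀ x, 0 ≤ x → y.w x = 0 ∧ y.U x = 0 := by
        intro x hx
        obtain ⟨h1, h2⟩ := hlate (max x T₂) (le_max_right _ _)
        exact h.w_eq_zero_of_later hx (le_max_left _ _) h1 h2
      refine ⟨?_, fun ρ hρ => (hall ρ hρ).1⟩
      have h1 := h.init_ζ
      have h2 : 0 < r₀ := by rw [← h.init_r]; exact h.r_pos' le_rfl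
      obtain ⟨h3, h4⟩ := hall 0 le_rfl
      rw [h.init_w] at h3
      rw [h.init_U] at h4
      have h5 : 0 < initialEnergy r₀ w₀ U₀ := Real.sqrt_pos.1 (by rw [← h1]; exact hζ0)
      rw [h3, h4] at h5
      simp only [initialEnergy] at h5
      have h6 : 1 / r₀ ^ 2 < 1 := by norm_num at h5 ⊢; linarith
      rw [div_lt_one (by positivity)] at h6
      nlinarith
    · exact Or.inr ⟨Or.inl hwm, hz⟩
    · exact Or.inr ⟨Or.inr hwm, hz⟩

end Flat

end IsSolutionOn

end HauntedEYM

theorem theorem2 (r₀ w₀ U₀ : ℝ) (hdata : (r₀, w₀, U₀) ∈ HauntedEYM.admissibleData)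
    (b : EReal) (y : HauntedEYM.Variables)
    (hy : HauntedEYM.IsMaximalSolution r₀ w₀ U₀ b y) :
    (HauntedEYM.IsSingular b y ∨ HauntedEYM.IsAsymptoticallyCylindrical r₀ b y ∨
        HauntedEYM.IsAsymptoticallyFlat r₀ b y) ∧
      ¬ (HauntedEYM.IsSingular b y ∧ HauntedEYM.IsAsymptoticallyCylindrical r₀ b y) ∧
      ¬ (HauntedEYM.IsSingular b y ∧ HauntedEYM.IsAsymptoticallyFlat r₀ b y) ∧
      ¬ (HauntedEYM.IsAsymptoticallyCylindrical r₀ b y ∧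
          HauntedEYM.IsAsymptoticallyFlat r₀ b y) := by
  obtain ⟨-, hw, hE⟩ := hdata
  refine ⟨?_, ?_, ?_, ?_⟩
  · induction b with
    | bot => exact absurd hy.1.b_pos (by simp)
    | coe c => exact Or.inl (hy.isSingular hE hw)
    | top =>
      right
      rcases hy.1.r_dichotomy hE with ⟨l, hl⟩ | hr
      · exact Or.inl (hy.1.isAsymptoticallyCylindrical hE hw hl)
      · exact Or.inr (hy.1.isAsymptoticallyFlat hE hw hr)
  · rintro ⟨⟨c, -, hc, -⟩, hb, -⟩
    exact EReal.coe_ne_top c (hc.symm.trans hb)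
  · rintro ⟨⟨c, -, hc, -⟩, hb, -⟩
    exact EReal.coe_ne_top c (hc.symm.trans hb)
  · rintro ⟨⟨-, -, hr, -⟩, -, -, hr', -⟩
    exact not_tendsto_nhds_of_tendsto_atTop hr' 1 hr
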